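/- Let $P$ be a locally finite simplicial poset: a poset with a least element $\hat 0$ (the empty face) in which every lower interval $P_{\le x}$ is a finite Boolean lattice and $P_{\ge x}$ is finite for every $x\neq\hat 0$. Let $P^j$ be the set of elements covering exactly $j+1$ elements (the $j$-faces of the $\Delta$-complex $\Delta_P$), fix a total order of the vertices, and let $C^j=\mathbb R^{P^j}$ ($j\ge -1$) be the augmented simplicial cochains with the usual coboundary $d$, with incidence numbers $[y:x]=\pm1$. Let $k\ge 1$. *Link graphs.* For $p\in P^{k-1}$ consider the (multi)graph with vertices the $b\in P^k$, $b>p$, and edges the $c\in P^{k+1}$, $c>p$, the ends of $c$ being the two $b$ with $p<b<c$. The Garland poset $\mathcal S_kP$ is $S^{-1}\cup S^0\cup S^1$ with $S^0=P^k$, $S^1=P^{k+1}$ (ordered as in $P$), and $S^{-1}$ the set of all connected components of these graphs, a component being smaller than its vertices and edges; the connected components of its link graph are the graphs $S_{>a}$, $a\in S^{-1}$. The spectral gap $\alpha_a\in(0,\infty]$ of $S_{>a}$ is the smallest non-zero eigenvalue of its normalized Laplacian $(\mathcal L f)(b)=\frac1{\deg b}\sum_{c\ni b}(f(b)-f(b'))$,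 where $b'$ is the other end of $c$ ($\alpha_a=\infty$ if the component has no edge). *Connecting maps.* For $p\in P^{k-1}$, $\lambda_p$ sends the class in $\widetilde H^0(\Delta_{P_{\ge p}};\mathbb R)$ of a locally constant function $f$ on the vertices of the link of $p$ to the class of the $k$-cocycle equal to $[p:b]\,f(b)$ on the $k$-faces $b$ covering $p$ and to $0$ on all other $k$-faces. *$\ell^2$-cohomology.* Let $m(x)=\max(1,\#\{c\in P^{k+1}: c\ge x\})$, and let $C^j_{(2)}$ be the space of $\varphi\in C^j$ with $\|\varphi\|^2=\sum_x m(x)\varphi(x)^2<\infty$. Let $Z^k_{(2)}=\{\varphi\in C^k_{(2)}: d\varphi=0\}$ and $B^k_{(2)}=C^k_{(2)}\cap d\,C^{k-1}_{(2)}$, with the Hausdorff cohomology $\overline H{}^k_{(2)}=Z^k_{(2)}/\overline{B^k_{(2)}}$ and the unreduced one $H^k_{(2)}=Z^k_{(2)}/B^k_{(2)}$. Suppose that $\alpha_a>\frac{k}{k+1}$ for every $a\in S^{-1}$. Then: 1. $\overline H{}^k_{(2)}$ is the closed span of the images of the maps $\lambda_p$, $p\in P^{k-1}$. 2. If moreover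 $\inf_a\alpha_a>\frac{k}{k+1}$, then every class in $H^k_{(2)}$ is the class of a cocycle $\sum_p\lambda_p(f_p)$, where $f_p$ is a locally constant function on the vertices of the link of $p$ and $\sum_p\sum_{b\gtrdot p}m(b)f_p(b)^2<\infty$. 3. If $P$ is finite, then the reduced simplicial cohomology $\widetilde H^k(\Delta_P;\mathbb R)$ equals $L_{k,P}$, the span of the images of the maps $\lambda_p$, $p\in P^{k-1}$. If in addition the link graph of every $p\in P^{k-1}$ is connected (or empty), then $\overline H{}^k_{(2)}=0$, in the situation of 2 also $H^k_{(2)}=0$, and in the situation of 3 also $\widetilde H^k(\Delta_P;\mathbb R)=0$ (Garland's vanishing theorem). -/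

import Mathlib

set_option linter.unusedSectionVars false

noncomputable section

open scoped Classical

namespace SimplicialPoset

universe u

/-! ### Simplicial posets and their faces -/

/-- A simplicial poset: a poset with least element (the empty face) all of whose lower intervals
are (finite) Boolean lattices. -/
structure IsSimplicial (P : Type u) [PartialOrder P] [OrderBot P] : Prop where
  boolean : ∀ x : P, ∃ n : ℕ, Nonempty (Set.Iic x ≃o Finset (Fin n))

/-- Local finiteness: every non-empty face lies in only finitely many faces. -/
def IsLocallyFinite (P : Type u) [PartialOrder P] [OrderBot P] : Prop :=
  ∀ x : P, x ≠ ⊥ → (Set.Ici x).Finite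

/-- `Face P n` is the set of elements covering exactly `n` elements, that is, the faces with `n`
vertices. They are the `(n - 1)`-dimensional faces; `Face P 0` consists of the empty face. -/
def Face (P : Type u) [PartialOrder P] (n : ℕ) : Type u :=
  {x : P // {y : P | y ⋖ x}.encard = n}

section Cochains

variable {P : Type u} [PartialOrder P] [OrderBot P]

theorem finite_facets {n m : ℕ} (x : Face P m) : {y : Face P n | y.1 ⋖ x.1}.Finite := by
  have h : {y : P | y ⋖ x.1}.Finite := Set.finite_of_encard_eq_coe x.2
  exact Set.Finite.preimage (f := fun y : Face P n => y.1) (Subtype.val_injective.injOn) h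

/-- The codimension one faces of `x`. -/
def facets {n : ℕ} (x : Face P (n + 1)) : Finset (Face P n) :=
  (finite_facets (n := n) x).toFinset

theorem mem_facets {n : ℕ} {x : Face P (n + 1)} {y : Face P n} :
    y ∈ facets x ↔ y.1 ⋖ x.1 := by
  simp [facets]

/-- The incidence sign of a codimension one face `y` of `x` with respect to an ordering `r` of the
vertices (the atoms): it is `(-1) ^ i` if `y` is obtained from `x` by leaving out the vertex `u` in
position `i` (counting from `0`), where `i` is the number of vertices `v` of `x` before `u`. -/
def sgn (r : P → P → Prop) (y x : P) : ℝ :=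
  (-1) ^ {v : P | IsAtom v ∧ v ≤ x ∧ ∃ u, IsAtom u ∧ u ≤ x ∧ ¬ u ≤ y ∧ r v u}.ncard

/-- Real cochains on the faces with `n` vertices, i.e. cochains of degree `n - 1`. -/
abbrev Cochain (P : Type u) [PartialOrder P] (n : ℕ) : Type u := Face P n → ℝ

/-- The simplicial coboundary map of the augmented cochain complex,
from degree `n - 1` to degree `n`. -/
def coboundary (r : P → P → Prop) (n : ℕ) : Cochain P n →ₗ[ℝ] Cochain P (n + 1) where
  toFun φ x := ∑ y ∈ facets x, sgn r y.1 x.1 * φ y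
  map_add' φ ψ := by
    funext x
    simp [mul_add, Finset.sum_add_distrib]
  map_smul' t φ := by
    funext x
    simp [Finset.mul_sum, mul_left_comm]

/-- Cocycles of degree `k`. -/
def cocycles (r : P → P → Prop) (k : ℕ) : Submodule ℝ (Cochain P (k + 1)) :=
  LinearMap.ker (coboundary r (k + 1))

/-- Coboundaries of degree `k`. -/
def coboundaries (r : P → P → Prop) (k : ℕ) : Submodule ℝ (Cochain P (k + 1)) :=
  LinearMap.range (coboundary r k)

/-- The reduced simplicial cohomology `H̃^k(Δ_P)` with real coefficients. -/
abbrev Cohomology (r : P → P → Prop) (k : ℕ) : Type u :=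
  cocycles r k ⧸ (coboundaries r k).comap (cocycles r k).subtype

end Cochains

/-! ### Links

The link of `p` is the simplicial complex of the poset `Set.Ici p`, with `p` as its empty face. -/

section Links

variable {P : Type u} [PartialOrder P] [OrderBot P]

/-- The ordering of the elements of `Set.Ici p` (in particular of the vertices of the link). -/
def linkOrder (r : P → P → Prop) (p : P) : Set.Ici p → Set.Ici p → Prop := fun x y => r x.1 y.1

theorem link_encard_one {p b : P} (h : p ⋖ b) :
    {y : Set.Ici p | y ⋖ (⟨b, h.le⟩ : Set.Ici p)}.encard = ((0 + 1 : ℕ) : ℕ∞) := by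
  have : {y : Set.Ici p | y ⋖ (⟨b, h.le⟩ : Set.Ici p)} = {(⊥ : Set.Ici p)} := by
    ext y
    simp only [Set.mem_ofPred_eq, Set.mem_singleton_iff]
    constructor
    · intro hy
      have h1 : y.1 < b := hy.lt
      have h2 : p ≤ y.1 := y.2
      rcases h2.eq_or_lt with h3 | h3
      · exact Subtype.ext h3.symm
      · exact absurd h1 (h.2 h3)
    · rintro rfl
      refine ⟨h.lt, ?_⟩
      intro z hz1 hz2
      exact h.2 (show p < z.1 from hz1) (show z.1 < b from hz2)
  rw [this]
  simp

/-- A face covering `p`, as a vertex of the link of `p`. -/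
def linkVertex {p : P} {k : ℕ} (b : Face P (k + 1)) (h : p ⋖ b.1) : Face (Set.Ici p) (0 + 1) :=
  ⟨⟨b.1, h.le⟩, link_encard_one h⟩

/-- The cochain of degree `k` on `P` which a function `f` on the vertices of the link of the
`(k-1)`-face `p` defines: it is `f`, up to the incidence sign with `p`, on the `k`-faces containing
`p`, and `0` on the other ones. -/
def extendLink (r : P → P → Prop) {k : ℕ} (p : Face P k) :
    Cochain (Set.Ici p.1) (0 + 1) →ₗ[ℝ] Cochain P (k + 1) where
  toFun f b := if h : p.1 ⋖ b.1 then sgn r p.1 b.1 * f (linkVertex b h) else 0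
  map_add' f g := by
    funext b
    by_cases h : p.1 ⋖ b.1 <;> simp [h, mul_add]
  map_smul' t f := by
    funext b
    by_cases h : p.1 ⋖ b.1 <;> simp [h, mul_left_comm]

end Links

section Boolean

variable {P : Type u} [PartialOrder P] [OrderBot P]

theorem IsSimplicial.exists_embedding (hP : IsSimplicial P) (c : P) :
    ∃ (n : ℕ) (G : Finset (Fin n) ↪o P), Set.range G = Set.Iic c := by
  obtain ⟨n, ⟨e⟩⟩ := hP.boolean c
  refine ⟨n, e.symm.toOrderEmbedding.trans (OrderEmbedding.subtype (· ∈ Set.Iic c)), ?_⟩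
  ext y
  constructor
  · rintro ⟨s, rfl⟩
    exact (e.symm s).2
  · intro hy
    exact ⟨e ⟨y, hy⟩, by simp⟩

variable {n : ℕ} {c : P} {G : Finset (Fin n) ↪o P}

theorem embedding_covBy (hG : Set.range G = Set.Iic c) {s t : Finset (Fin n)} :
    G s ⋖ G t ↔ s ⋖ t := by
  apply Set.OrdConnected.apply_covBy_apply_iff
  rw [hG]
  exact Set.ordConnected_Iic

theorem embedding_empty (hG : Set.range G = Set.Iic c) : G ∅ = ⊥ := by
  have : (⊥ : P) ∈ Set.range G := by rw [hG]; exact bot_le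
  obtain ⟨s, hs⟩ := this
  apply le_antisymm _ bot_le
  rw [← hs]
  exact G.monotone (Finset.empty_subset s)

theorem embedding_exists (hG : Set.range G = Set.Iic c) {y : P} {t : Finset (Fin n)}
    (h : y ≤ G t) : ∃ s, G s = y ∧ s ⊆ t := by
  have h1 : G t ∈ Set.Iic c := hG ▸ Set.mem_range_self t
  have h2 : y ∈ Set.range G := by rw [hG]; exact h.trans h1
  obtain ⟨s, rfl⟩ := h2
  exact ⟨s, rfl, G.le_iff_le.1 h⟩

theorem embedding_univ (hG : Set.range G = Set.Iic c) : G Finset.univ = c := by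
  have h1 : G Finset.univ ∈ Set.Iic c := hG ▸ Set.mem_range_self _
  have h2 : c ∈ Set.range G := by rw [hG]; exact le_refl c
  obtain ⟨s, hs⟩ := h2
  exact le_antisymm h1 (hs ▸ G.monotone (Finset.subset_univ s))

theorem embedding_atom (hG : Set.range G = Set.Iic c) {s : Finset (Fin n)} :
    IsAtom (G s) ↔ ∃ i, s = {i} := by
  rw [← bot_covBy_iff, ← embedding_empty hG, embedding_covBy hG, Finset.covBy_iff_exists_insert]
  constructor
  · rintro ⟨i, -, rfl⟩
    exact ⟨i, rfl⟩
  · rintro ⟨i, rfl⟩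
    exact ⟨i, by simp, rfl⟩

theorem embedding_encard (hG : Set.range G = Set.Iic c) (s : Finset (Fin n)) :
    {y : P | y ⋖ G s}.encard = s.card := by
  have : {y : P | y ⋖ G s} = (fun i => G (s.erase i)) '' (s : Set (Fin n)) := by
    ext y
    simp only [Set.mem_ofPred_eq, Set.mem_image, Finset.mem_coe]
    constructor
    · intro h
      obtain ⟨t, rfl, -⟩ := embedding_exists hG h.le
      rw [embedding_covBy hG, Finset.covBy_iff_exists_erase] at h
      obtain ⟨i, hi, rfl⟩ := h
      exact ⟨i, hi, rfl⟩
    · rintro ⟨i, hi, rfl⟩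
      rw [embedding_covBy hG, Finset.covBy_iff_exists_erase]
      exact ⟨i, hi, rfl⟩
  rw [this, Set.InjOn.encard_image]
  · simp
  · intro i hi j hj hij
    have h1 : s.erase i = s.erase j := G.injective hij
    by_contra hne
    have : j ∈ s.erase i := Finset.mem_erase.2 ⟨fun h => hne h.symm, hj⟩
    rw [h1] at this
    simp at this

theorem sgn_embedding (r : P → P → Prop) [IsStrictTotalOrder P r]
    (hG : Set.range G = Set.Iic c) {s : Finset (Fin n)} {i : Fin n} (hi : i ∉ s) :
    sgn r (G s) (G (insert i s)) = (-1) ^ (s.filter fun j => r (G {j}) (G {i})).card := by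
  unfold sgn
  congr 1
  have : {v : P | IsAtom v ∧ v ≤ G (insert i s) ∧
      ∃ u, IsAtom u ∧ u ≤ G (insert i s) ∧ ¬ u ≤ G s ∧ r v u} =
      (fun j => G {j}) '' ((s.filter fun j => r (G {j}) (G {i}) : Finset (Fin n)) :
        Set (Fin n)) := by
    ext v
    simp only [Set.mem_ofPred_eq, Set.mem_image, Finset.coe_filter]
    constructor
    · rintro ⟨hv, hvx, u, hu, hux, huy, hr⟩
      obtain ⟨t, rfl, ht⟩ := embedding_exists hG hvx
      obtain ⟨t', rfl, ht'⟩ := embedding_exists hG hux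
      obtain ⟨j, rfl⟩ := (embedding_atom hG).1 hv
      obtain ⟨j', rfl⟩ := (embedding_atom hG).1 hu
      rw [G.le_iff_le] at huy
      have h1 : j' = i := by
        have h3 := ht' (Finset.mem_singleton_self j')
        rcases Finset.mem_insert.1 h3 with h | h
        · exact h
        · exact absurd (Finset.singleton_subset_iff.2 h) huy
      subst h1
      refine ⟨j, ⟨?_, hr⟩, rfl⟩
      rcases Finset.mem_insert.1 (ht (Finset.mem_singleton_self j)) with h | h
      · subst h
        exact absurd hr (irrefl _)
      · exact h
    · rintro ⟨j, ⟨hj, hr⟩, rfl⟩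
      refine ⟨(embedding_atom hG).2 ⟨j, rfl⟩, ?_, G {i}, (embedding_atom hG).2 ⟨i, rfl⟩, ?_, ?_, hr⟩
      · exact G.monotone (Finset.singleton_subset_iff.2 (Finset.mem_insert_of_mem hj))
      · exact G.monotone (Finset.singleton_subset_iff.2 (Finset.mem_insert_self _ _))
      · rw [G.le_iff_le]
        exact fun h => hi (Finset.singleton_subset_iff.1 h)
  rw [this, Set.ncard_image_of_injective, Set.ncard_coe_finset]
  intro a b hab
  exact Finset.singleton_injective (G.injective hab)

/-- Two faces whose dimensions differ by two have exactly two faces in between, and the products of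
the incidence signs along the two ways are opposite. -/
theorem IsSimplicial.diamond (hP : IsSimplicial P) (r : P → P → Prop) [IsStrictTotalOrder P r]
    {k : ℕ} (p : Face P k) (c : Face P (k + 1 + 1)) (hpc : p.1 ≤ c.1) :
    ∃ b b' : P, b ≠ b' ∧ (∀ y : P, p.1 ⋖ y → (y ≤ c.1 ↔ y = b ∨ y = b')) ∧
      (∀ y : P, p.1 ≤ y → (y ⋖ c.1 ↔ y = b ∨ y = b')) ∧ p.1 ⋖ b ∧ p.1 ⋖ b' ∧
      {y : P | y ⋖ b}.encard = ((k + 1 : ℕ) : ℕ∞) ∧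
      {y : P | y ⋖ b'}.encard = ((k + 1 : ℕ) : ℕ∞) ∧
      sgn r p.1 b * sgn r b c.1 = -(sgn r p.1 b' * sgn r b' c.1) := by
  obtain ⟨n, G, hG⟩ := hP.exists_embedding c.1
  have hc : G Finset.univ = c.1 := embedding_univ hG
  obtain ⟨s, hs, -⟩ := embedding_exists hG (hpc.trans hc.ge)
  have hn : n = k + 1 + 1 := by
    have h1 := embedding_encard hG Finset.univ
    rw [hc, c.2] at h1
    simpa using (Nat.cast_injective h1).symm
  have hk : s.card = k := by
    have h1 := embedding_encard hG s
    rw [hs, p.2] at h1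
    exact (Nat.cast_injective h1).symm
  have hcompl : sᶜ.card = 2 := by
    rw [Finset.card_compl, hk, Fintype.card_fin, hn]; omega
  obtain ⟨i, j, hij, hsc⟩ := Finset.card_eq_two.1 hcompl
  have hmem : ∀ x, x ∉ s ↔ x = i ∨ x = j := by
    intro x
    rw [← Finset.mem_compl, hsc]
    simp
  have hi : i ∉ s := (hmem i).2 (Or.inl rfl)
  have hj : j ∉ s := (hmem j).2 (Or.inr rfl)
  have hji : j ∉ insert i s := by
    rw [Finset.mem_insert]; rintro (h | h)
    · exact hij h.symm
    · exact hj h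
  have hij' : i ∉ insert j s := by
    rw [Finset.mem_insert]; rintro (h | h)
    · exact hij h
    · exact hi h
  have hui : insert j (insert i s) = Finset.univ := by
    ext x
    simp only [Finset.mem_insert, Finset.mem_univ, iff_true]
    by_cases hx : x ∈ s
    · exact Or.inr (Or.inr hx)
    · rcases (hmem x).1 hx with h | h
      · exact Or.inr (Or.inl h)
      · exact Or.inl h
  have huj : insert i (insert j s) = Finset.univ := by rw [Finset.insert_comm]; exact hui
  have hpb : G s ⋖ G (insert i s) := (embedding_covBy hG).2 (Finset.covBy_insert hi)
  have hpb' : G s ⋖ G (insert j s) := (embedding_covBy hG).2 (Finset.covBy_insert hj)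
  have hbc : G (insert i s) ⋖ G Finset.univ := by
    rw [← hui]; exact (embedding_covBy hG).2 (Finset.covBy_insert hji)
  have hbc' : G (insert j s) ⋖ G Finset.univ := by
    rw [← huj]; exact (embedding_covBy hG).2 (Finset.covBy_insert hij')
  have key : ∀ y : P, G s ⋖ y → y ≤ G Finset.univ → y = G (insert i s) ∨ y = G (insert j s) := by
    intro y hy hyc
    obtain ⟨t, rfl, -⟩ := embedding_exists hG hyc
    rw [embedding_covBy hG, Finset.covBy_iff_exists_insert] at hy
    obtain ⟨a, ha, rfl⟩ := hy
    rcases (hmem a).1 ha with rfl | rfl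
    · exact Or.inl rfl
    · exact Or.inr rfl
  refine ⟨G (insert i s), G (insert j s), ?_, ?_, ?_, ?_, ?_, ?_, ?_, ?_⟩
  · intro h
    have h1 := G.injective h
    exact hij' (h1 ▸ Finset.mem_insert_self i s)
  · intro y hy
    rw [← hs] at hy
    rw [← hc]
    constructor
    · exact key y hy
    · rintro (rfl | rfl)
      · exact hbc.le
      · exact hbc'.le
  · intro y hy
    rw [← hs] at hy
    rw [← hc]
    constructor
    · intro h
      obtain ⟨t, rfl, -⟩ := embedding_exists hG h.le
      refine key _ ?_ h.le
      rw [embedding_covBy hG]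
      rw [embedding_covBy hG, Finset.covBy_iff_exists_erase] at h
      obtain ⟨a, -, rfl⟩ := h
      rw [G.le_iff_le] at hy
      rw [Finset.covBy_iff_card_sdiff_eq_one]
      refine ⟨hy, ?_⟩
      rw [Finset.card_sdiff_of_subset hy, Finset.card_erase_of_mem (Finset.mem_univ a),
        Finset.card_univ, Fintype.card_fin, hk, hn]
      omega
    · rintro (rfl | rfl)
      · exact hbc
      · exact hbc'
  · rw [← hs]; exact hpb
  · rw [← hs]; exact hpb'
  · rw [embedding_encard hG, Finset.card_insert_of_notMem hi, hk]
  · rw [embedding_encard hG, Finset.card_insert_of_notMem hj, hk]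
  · rw [← hs, ← hc, sgn_embedding r hG hi, sgn_embedding r hG hj]
    have e1 := sgn_embedding r hG hji
    have e2 := sgn_embedding r hG hij'
    rw [hui] at e1
    rw [huj] at e2
    rw [e1, e2, Finset.filter_insert, Finset.filter_insert]
    have hGne : G {i} ≠ G {j} := fun h => hij (Finset.singleton_injective (G.injective h))
    rcases trichotomous_of r (G {i}) (G {j}) with h | h | h
    · have h' : ¬ r (G {j}) (G {i}) := asymm h
      rw [if_pos h, if_neg h', Finset.card_insert_of_notMem (by simp [hi])]
      ring
    · exact absurd h hGne
    · have h' : ¬ r (G {i}) (G {j}) := asymm h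
      rw [if_pos h, if_neg h', Finset.card_insert_of_notMem (by simp [hj])]
      ring

end Boolean

/-! ### The connecting homomorphisms -/

section Connecting

variable {P : Type u} [PartialOrder P] [OrderBot P]

theorem link_covBy {p : P} {x y : Set.Ici p} : x ⋖ y ↔ x.1 ⋖ y.1 := by
  have h := Set.OrdConnected.apply_covBy_apply_iff (a := x) (b := y)
    (OrderEmbedding.subtype (· ∈ Set.Ici p)) (by
      have : Set.range (OrderEmbedding.subtype (· ∈ Set.Ici p)) = Set.Ici p := by
        ext z; simp
      rw [this]; exact Set.ordConnected_Ici)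
  exact h.symm

theorem link_sgn (r : P → P → Prop) [IsStrictTotalOrder P r] {p b b' c : P} (hb : p ⋖ b)
    (hb' : p ⋖ b') (hne : b ≠ b') (hc : p ≤ c)
    (hall : ∀ y : P, p ⋖ y → (y ≤ c ↔ y = b ∨ y = b')) :
    sgn (linkOrder r p) (⟨b, hb.le⟩ : Set.Ici p) ⟨c, hc⟩ = if r b b' then -1 else 1 := by
  have hnle : ¬ b' ≤ b := by
    intro h
    rcases h.eq_or_lt with h | h
    · exact hne h.symm
    · exact hb.2 hb'.lt h
  unfold sgn
  have : {v : Set.Ici p | IsAtom v ∧ v ≤ ⟨c, hc⟩ ∧ ∃ u, IsAtom u ∧ u ≤ ⟨c, hc⟩ ∧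
      ¬ u ≤ ⟨b, hb.le⟩ ∧ linkOrder r p v u} = if r b b' then {⟨b, hb.le⟩} else ∅ := by
    have hatom : ∀ v : Set.Ici p, IsAtom v ↔ p ⋖ v.1 := by
      intro v
      rw [← bot_covBy_iff, link_covBy]
      rfl
    ext v
    have hL : v ∈ {v : Set.Ici p | IsAtom v ∧ v ≤ ⟨c, hc⟩ ∧ ∃ u, IsAtom u ∧ u ≤ ⟨c, hc⟩ ∧
      ¬ u ≤ ⟨b, hb.le⟩ ∧ linkOrder r p v u} ↔ (v.1 = b ∧ r b b') := by
      rw [Set.mem_ofPred_eq]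
      constructor
      · rintro ⟨hv, hvc, w, hw, hwc, hwb, hr⟩
        rw [hatom] at hv hw
        have hw' : w.1 = b' := by
          rcases (hall _ hw).1 hwc with h | h
          · exact absurd (show w ≤ ⟨b, hb.le⟩ from h.le) hwb
          · exact h
        have hr' : r v.1 b' := hw' ▸ hr
        rcases (hall _ hv).1 hvc with h | h
        · exact ⟨h, h ▸ hr'⟩
        · rw [h] at hr'
          exact absurd hr' (irrefl _)
      · rintro ⟨hv, hr⟩
        refine ⟨?_, ?_, ⟨b', hb'.le⟩, ?_, ?_, ?_, ?_⟩
        · rw [hatom, hv]; exact hb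
        · show v.1 ≤ c
          rw [hv]; exact (hall _ hb).2 (Or.inl rfl)
        · rw [hatom]; exact hb'
        · exact (hall _ hb').2 (Or.inr rfl)
        · exact hnle
        · show r v.1 b'
          rw [hv]; exact hr
    rw [hL]
    by_cases hr : r b b'
    · simp [hr, Subtype.ext_iff]
    · simp [hr]
  rw [this]
  by_cases hr : r b b' <;> simp [hr]

theorem extendLink_mem_cocycles (hP : IsSimplicial P) (r : P → P → Prop) [IsStrictTotalOrder P r]
    {k : ℕ} (p : Face P k) {f : Cochain (Set.Ici p.1) (0 + 1)}
    (hf : f ∈ cocycles (linkOrder r p.1) 0) : extendLink r p f ∈ cocycles r k := by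
  rw [cocycles, LinearMap.mem_ker] at hf ⊢
  funext c
  show ∑ b ∈ facets c, sgn r b.1 c.1 * extendLink r p f b = 0
  by_cases hpc : p.1 ≤ c.1
  swap
  · refine Finset.sum_eq_zero fun b hb => ?_
    have : ¬ p.1 ⋖ b.1 := fun h => hpc (h.le.trans (mem_facets.1 hb).le)
    simp [extendLink, this]
  obtain ⟨b, b', hne, h1, h2, hb, hb', hkb, hkb', hs⟩ := hP.diamond r p c hpc
  set B : Face P (k + 1) := ⟨b, hkb⟩ with hB
  set B' : Face P (k + 1) := ⟨b', hkb'⟩ with hB'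
  have hBne : B ≠ B' := fun h => hne (congrArg Subtype.val h)
  have hlink : {y : Set.Ici p.1 | y ⋖ (⟨c.1, hpc⟩ : Set.Ici p.1)} =
      {⟨b, hb.le⟩, ⟨b', hb'.le⟩} := by
    ext y
    rw [Set.mem_ofPred_eq, link_covBy, h2 y.1 y.2]
    simp [Subtype.ext_iff]
  let C : Face (Set.Ici p.1) (0 + 1 + 1) := ⟨⟨c.1, hpc⟩, by
    rw [hlink, Set.encard_pair (by simpa [Subtype.ext_iff] using hne)]
    norm_num⟩
  have hfC : ∑ y ∈ facets C, sgn (linkOrder r p.1) y.1 C.1 * f y = 0 := congrFun hf C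
  have hfac : facets C = {linkVertex B hb, linkVertex B' hb'} := by
    ext y
    rw [mem_facets, link_covBy]
    have := h2 y.1.1 y.1.2
    rw [show y.1.1 ⋖ C.1.1 ↔ _ from this]
    rw [Finset.mem_insert, Finset.mem_singleton]
    refine or_congr ⟨fun h => Subtype.ext (Subtype.ext h), fun h => ?_⟩
      ⟨fun h => Subtype.ext (Subtype.ext h), fun h => ?_⟩
    · rw [h]; rfl
    · rw [h]; rfl
  have hvne : linkVertex B hb ≠ linkVertex B' hb' := by
    intro h
    exact hne (congrArg (fun y => y.1.1) h)
  rw [hfac, Finset.sum_pair hvne] at hfC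
  have e1 : sgn (linkOrder r p.1) (linkVertex B hb).1 C.1 = if r b b' then -1 else 1 :=
    link_sgn r hb hb' hne hpc h1
  have e2 : sgn (linkOrder r p.1) (linkVertex B' hb').1 C.1 = if r b' b then -1 else 1 :=
    link_sgn r hb' hb hne.symm hpc (fun y hy => by rw [h1 y hy, or_comm])
  have hff : f (linkVertex B hb) = f (linkVertex B' hb') := by
    rw [e1, e2] at hfC
    rcases trichotomous_of r b b' with h | h | h
    · have h' : ¬ r b' b := asymm h
      rw [if_pos h, if_neg h'] at hfC
      linarith
    · exact absurd h hne
    · have h' : ¬ r b b' := asymm h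
      rw [if_pos h, if_neg h'] at hfC
      linarith
  have hsub : ({B, B'} : Finset (Face P (k + 1))) ⊆ facets c := by
    intro y hy
    rw [mem_facets]
    rcases Finset.mem_insert.1 hy with rfl | hy
    · exact (h2 b hb.le).2 (Or.inl rfl)
    · rw [Finset.mem_singleton.1 hy]
      exact (h2 b' hb'.le).2 (Or.inr rfl)
  rw [← Finset.sum_subset hsub, Finset.sum_pair hBne]
  · have x1 : extendLink r p f B = sgn r p.1 b * f (linkVertex B hb) := dif_pos hb
    have x2 : extendLink r p f B' = sgn r p.1 b' * f (linkVertex B' hb') := dif_pos hb'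
    rw [x1, x2, hff]
    linear_combination (f (linkVertex B' hb')) * hs
  · intro y hy hy'
    have : ¬ p.1 ⋖ y.1 := by
      intro h
      apply hy'
      rcases (h1 y.1 h).1 (mem_facets.1 hy).le with h | h
      · rw [Finset.mem_insert]
        exact Or.inl (Subtype.ext h)
      · rw [Finset.mem_insert, Finset.mem_singleton]
        exact Or.inr (Subtype.ext h)
    simp [extendLink, this]

theorem extendLink_coboundary (r : P → P → Prop) [IsStrictTotalOrder P r]
    {k : ℕ} (p : Face P k) (g : Cochain (Set.Ici p.1) 0) :
    ∃ t : ℝ, extendLink r p (coboundary (linkOrder r p.1) 0 g) =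
      coboundary r k (Pi.single p t) := by
  have hbot : {y : Set.Ici p.1 | y ⋖ (⊥ : Set.Ici p.1)}.encard = ((0 : ℕ) : ℕ∞) := by
    have : {y : Set.Ici p.1 | y ⋖ (⊥ : Set.Ici p.1)} = ∅ := by
      ext y
      simp only [Set.mem_ofPred_eq, Set.mem_empty_iff_false, iff_false]
      exact fun h => not_lt_bot h.lt
    rw [this]; simp
  let O : Face (Set.Ici p.1) 0 := ⟨⊥, hbot⟩
  refine ⟨g O, ?_⟩
  funext b
  have hR : coboundary r k (Pi.single p (g O)) b = if p.1 ⋖ b.1 then sgn r p.1 b.1 * g O else 0 := by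
    show ∑ y ∈ facets b, sgn r y.1 b.1 * (Pi.single p (g O) : Face P k → ℝ) y = _
    simp only [Pi.single_apply, mul_ite, mul_zero]
    rw [Finset.sum_ite_eq' (facets b) p]
    simp only [mem_facets]
  rw [hR]
  by_cases h : p.1 ⋖ b.1
  swap
  · simp [extendLink, h]
  rw [if_pos h]
  have x1 : extendLink r p (coboundary (linkOrder r p.1) 0 g) b =
    sgn r p.1 b.1 * (coboundary (linkOrder r p.1) 0 g) (linkVertex b h) := dif_pos h
  rw [x1]
  congr 1
  have hfac : facets (linkVertex b h) = {O} := by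
    ext y
    rw [mem_facets, Finset.mem_singleton, link_covBy]
    constructor
    · intro hy
      apply Subtype.ext
      apply Subtype.ext
      show y.1.1 = p.1
      have h2 : p.1 ≤ y.1.1 := y.1.2
      rcases h2.eq_or_lt with h3 | h3
      · exact h3.symm
      · exact absurd hy.lt (h.2 h3)
    · rintro rfl
      exact h
  show ∑ y ∈ facets (linkVertex b h), sgn (linkOrder r p.1) y.1 (linkVertex b h).1 * g y = g O
  rw [hfac, Finset.sum_singleton]
  have hsg : sgn (linkOrder r p.1) O.1 (linkVertex b h).1 = 1 := by
    unfold sgn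
    have hatom : ∀ v : Set.Ici p.1, IsAtom v → v ≤ (linkVertex b h).1 → v.1 = b.1 := by
      intro v hv hvb
      rw [← bot_covBy_iff, link_covBy] at hv
      rcases (show v.1 ≤ b.1 from hvb).eq_or_lt with h3 | h3
      · exact h3
      · exact absurd h3 (h.2 hv.lt)
    have : {v : Set.Ici p.1 | IsAtom v ∧ v ≤ (linkVertex b h).1 ∧ ∃ u, IsAtom u ∧
        u ≤ (linkVertex b h).1 ∧ ¬ u ≤ O.1 ∧ linkOrder r p.1 v u} = ∅ := by
      ext v
      simp only [Set.mem_ofPred_eq, Set.mem_empty_iff_false, iff_false]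
      rintro ⟨hv, hvb, w, hw, hwb, -, hr⟩
      have hr' : r v.1 w.1 := hr
      rw [hatom v hv hvb, hatom w hw hwb] at hr'
      exact irrefl _ hr'
    rw [this]; simp
  rw [hsg, one_mul]

/-- `extendLink` on cocycles. -/
def extendCocycle (hP : IsSimplicial P) (r : P → P → Prop) [IsStrictTotalOrder P r] {k : ℕ}
    (p : Face P k) : cocycles (linkOrder r p.1) 0 →ₗ[ℝ] cocycles r k :=
  (extendLink r p).restrict fun _ hf => extendLink_mem_cocycles hP r p hf

/-- The connecting homomorphism `λ_p : H̃^0(Δ_{P_{≥ p}}) → H̃^k(Δ_P)` of a `(k-1)`-face `p`. -/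
def connecting (hP : IsSimplicial P) (r : P → P → Prop) [IsStrictTotalOrder P r] {k : ℕ}
    (p : Face P k) : Cohomology (linkOrder r p.1) 0 →ₗ[ℝ] Cohomology r k :=
  Submodule.mapQ _ _ (extendCocycle hP r p) (by
    rintro f ⟨g, hg⟩
    obtain ⟨t, ht⟩ := extendLink_coboundary r p g
    refine ⟨Pi.single p t, ?_⟩
    rw [← ht, hg]
    rfl)

/-- `L_{k,P}`: the span of the images of the connecting homomorphisms in `H̃^k(Δ_P)`. -/
def linkSpan (hP : IsSimplicial P) (r : P → P → Prop) [IsStrictTotalOrder P r] (k : ℕ) :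
    Submodule ℝ (Cohomology (P := P) r k) :=
  ⨆ p : Face P k, LinearMap.range (connecting hP r p)

end Connecting

/-! ### Square-summable cochains -/

section L2

/-- The weight of a face `x`: the number of `(k+1)`-dimensional faces containing `x`
(and `1` if there is none). -/
def weight {P : Type u} [PartialOrder P] (k : ℕ) (x : P) : ℝ :=
  max 1 ({c : Face P (k + 1 + 1) | x ≤ c.1}.ncard : ℝ)

theorem weight_pos {P : Type u} [PartialOrder P] (k : ℕ) (x : P) : 0 < weight k x :=
  lt_of_lt_of_le one_pos (le_max_left _ _)

/-- The square-summable cochains of degree `n - 1` for the weight `weight k`. -/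
def sqSummable (P : Type u) [PartialOrder P] (k n : ℕ) : Submodule ℝ (Cochain P n) where
  carrier := {φ | Summable fun x : Face P n => weight k x.1 * φ x ^ 2}
  add_mem' := by
    intro φ ψ hφ hψ
    refine Summable.of_nonneg_of_le (fun x => ?_) (fun x => ?_)
      ((Summable.mul_left 2 hφ).add (Summable.mul_left 2 hψ))
    · exact mul_nonneg (weight_pos k x.1).le (sq_nonneg _)
    · have h := weight_pos k x.1
      simp only [Pi.add_apply]
      nlinarith [mul_nonneg h.le (sq_nonneg (φ x - ψ x))]
  zero_mem' := by
    show Summable _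
    simp
  smul_mem' := by
    intro t φ hφ
    refine (Summable.mul_left (t ^ 2) hφ).congr fun x => ?_
    simp only [Pi.smul_apply, smul_eq_mul]
    ring

/-- The Hilbert space of square-summable cochains of degree `n - 1`, with
`‖φ‖ ^ 2 = ∑ x, weight k x * φ x ^ 2`. -/
def L2Cochain (P : Type u) [PartialOrder P] (k n : ℕ) : Type u := sqSummable P k n

variable {P : Type u} [PartialOrder P]

instance (k n : ℕ) : AddCommGroup (L2Cochain P k n) :=
  inferInstanceAs (AddCommGroup (sqSummable P k n))

instance (k n : ℕ) : Module ℝ (L2Cochain P k n) :=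
  inferInstanceAs (Module ℝ (sqSummable P k n))

/-- The underlying cochain. -/
def L2Cochain.val (k n : ℕ) : L2Cochain P k n →ₗ[ℝ] Cochain P n := (sqSummable P k n).subtype

/-- The isometry `φ ↦ √weight * φ` to the standard `ℓ²` space, which defines the norm. -/
def L2Cochain.toLp (k n : ℕ) : L2Cochain P k n →ₗ[ℝ] lp (fun _ : Face P n => ℝ) 2 where
  toFun φ := ⟨fun x => √(weight k x.1) * L2Cochain.val k n φ x, by
    apply memℓp_gen
    have h : Summable fun x : Face P n => weight k x.1 * L2Cochain.val k n φ x ^ 2 := φ.2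
    refine h.congr fun x => ?_
    have h2 : ((2 : ENNReal).toReal) = ((2 : ℕ) : ℝ) := by simp
    rw [h2, Real.rpow_natCast, Real.norm_eq_abs, sq_abs, mul_pow, Real.sq_sqrt (weight_pos k x.1).le]⟩
  map_add' φ ψ := by
    ext x
    simp only [map_add, Pi.add_apply, mul_add]
    rfl
  map_smul' t φ := by
    ext x
    simp [mul_left_comm]

theorem L2Cochain.toLp_injective (k n : ℕ) :
    Function.Injective (L2Cochain.toLp (P := P) k n) := by
  intro φ ψ h
  apply Subtype.ext
  funext x
  have h1 := congrArg (fun f : lp (fun _ : Face P n => ℝ) 2 => f x) h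
  have h2 : √(weight k x.1) ≠ 0 := (Real.sqrt_pos.2 (weight_pos k x.1)).ne'
  exact mul_left_cancel₀ h2 h1

instance (k n : ℕ) : NormedAddCommGroup (L2Cochain P k n) :=
  NormedAddCommGroup.induced _ _ (L2Cochain.toLp k n) (L2Cochain.toLp_injective k n)

instance (k n : ℕ) : NormedSpace ℝ (L2Cochain P k n) :=
  NormedSpace.induced ℝ _ _ (L2Cochain.toLp k n)

variable [OrderBot P]

/-- Square-summable cocycles of degree `k`. -/
def l2Cocycles (r : P → P → Prop) (k : ℕ) : Submodule ℝ (L2Cochain P k (k + 1)) :=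
  (cocycles r k).comap (L2Cochain.val k (k + 1))

/-- Square-summable cochains which are coboundaries of square-summable cochains, as a subspace of
the square-summable cocycles. -/
def l2Coboundaries (r : P → P → Prop) (k : ℕ) : Submodule ℝ (l2Cocycles (P := P) r k) :=
  ((sqSummable P k k).map (coboundary r k)).comap
    (L2Cochain.val k (k + 1) ∘ₗ (l2Cocycles r k).subtype)

/-- The `ℓ²`-cohomology of `Δ_P` in degree `k`: cocycles modulo coboundaries. -/
abbrev L2Cohomology (r : P → P → Prop) (k : ℕ) : Type u :=
  l2Cocycles (P := P) r k ⧸ l2Coboundaries (P := P) r k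

/-- The Hausdorff `ℓ²`-cohomology of `Δ_P` in degree `k`: cocycles modulo the closure of the
coboundaries. -/
abbrev HausdorffL2Cohomology (r : P → P → Prop) (k : ℕ) : Type u :=
  l2Cocycles (P := P) r k ⧸ (l2Coboundaries (P := P) r k).topologicalClosure

theorem Face.ne_bot {k : ℕ} (hk : 1 ≤ k) (p : Face P k) : p.1 ≠ ⊥ := by
  intro h
  have h1 := p.2
  have : {y : P | y ⋖ p.1} = ∅ := by
    ext y
    simp only [Set.mem_ofPred_eq, Set.mem_empty_iff_false, iff_false, h]
    exact fun h => not_lt_bot h.lt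
  rw [this, Set.encard_empty] at h1
  have h2 : (0 : ℕ) = k := by exact_mod_cast h1
  omega

theorem extendLink_mem_sqSummable (hL : IsLocallyFinite P) (r : P → P → Prop) {k : ℕ} (hk : 1 ≤ k)
    (p : Face P k) (f : Cochain (Set.Ici p.1) (0 + 1)) :
    extendLink r p f ∈ sqSummable P k (k + 1) := by
  have hfin : {b : Face P (k + 1) | p.1 ≤ b.1}.Finite :=
    (hL p.1 (p.ne_bot hk)).preimage (f := fun b : Face P (k + 1) => b.1)
      Subtype.val_injective.injOn
  refine summable_of_ne_finset_zero (s := hfin.toFinset) fun b hb => ?_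
  have : ¬ p.1 ⋖ b.1 := fun h => hb (by simpa using h.le)
  simp [extendLink, this]

theorem single_mem_sqSummable {k n : ℕ} (p : Face P n) (t : ℝ) :
    (Pi.single p t : Cochain P n) ∈ sqSummable P k n := by
  refine summable_of_ne_finset_zero (s := {p}) fun b hb => ?_
  have : b ≠ p := by simpa using hb
  simp [this]

/-- `extendLink` as a map to square-summable cocycles. -/
def extendL2Cocycle (hP : IsSimplicial P) (hL : IsLocallyFinite P) (r : P → P → Prop)
    [IsStrictTotalOrder P r] {k : ℕ} (hk : 1 ≤ k) (p : Face P k) :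
    cocycles (linkOrder r p.1) 0 →ₗ[ℝ] l2Cocycles (P := P) r k :=
  LinearMap.codRestrict (l2Cocycles r k)
    (LinearMap.codRestrict (sqSummable P k (k + 1))
      (extendLink r p ∘ₗ (cocycles (linkOrder r p.1) 0).subtype)
      fun f => extendLink_mem_sqSummable hL r hk p f.1)
    fun f => extendLink_mem_cocycles hP r p f.2

/-- The connecting homomorphism `λ_p` with values in the Hausdorff `ℓ²`-cohomology. -/
def connectingL2 (hP : IsSimplicial P) (hL : IsLocallyFinite P) (r : P → P → Prop)
    [IsStrictTotalOrder P r] {k : ℕ} (hk : 1 ≤ k) (p : Face P k) :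
    Cohomology (linkOrder r p.1) 0 →ₗ[ℝ] HausdorffL2Cohomology (P := P) r k :=
  Submodule.mapQ _ _ (extendL2Cocycle hP hL r hk p) (by
    rintro f ⟨g, hg⟩
    obtain ⟨t, ht⟩ := extendLink_coboundary r p g
    refine Submodule.le_topologicalClosure _ ⟨Pi.single p t, single_mem_sqSummable p t, ?_⟩
    rw [← ht, hg]
    rfl)

/-- The closed span of the images of the connecting homomorphisms in the Hausdorff
`ℓ²`-cohomology. -/
def closedLinkSpan (hP : IsSimplicial P) (hL : IsLocallyFinite P) (r : P → P → Prop)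
    [IsStrictTotalOrder P r] {k : ℕ} (hk : 1 ≤ k) :
    Submodule ℝ (HausdorffL2Cohomology (P := P) r k) :=
  (⨆ p : Face P k, LinearMap.range (connectingL2 hP hL r hk p)).topologicalClosure

/-- Families of `0`-cocycles of the links of all `(k-1)`-faces which are square-summable
(the elements of the Hilbert sum of the spaces of `0`-cocycles of the links). -/
def linkFamilies (r : P → P → Prop) (k : ℕ) :
    Set (∀ p : Face P k, cocycles (linkOrder r p.1) 0) :=
  {f | Summable fun x : (Σ p : Face P k, {b : Face P (k + 1) // p.1 ⋖ b.1}) =>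
    weight k x.2.1.1 * (f x.1).1 (linkVertex x.2.1 x.2.2) ^ 2}

/-- The sum `∑_p λ_p(f_p)` on the level of cochains (in each face only finitely many terms are
non-zero). -/
def sumExtend (r : P → P → Prop) {k : ℕ} (f : ∀ p : Face P k, cocycles (linkOrder r p.1) 0) :
    Cochain P (k + 1) :=
  fun b => ∑ p ∈ facets b, extendLink r p (f p).1 b

/-- The classes in the `ℓ²`-cohomology which are square-summable sums of images of the connecting
homomorphisms, i.e. the image of the Hilbert sum of the spaces `H̃^0` of the links. -/
def hilbertLinkSum (r : P → P → Prop) (k : ℕ) : Set (L2Cohomology (P := P) r k) :=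
  {h | ∃ f ∈ linkFamilies r k, ∃ z : l2Cocycles (P := P) r k,
    L2Cochain.val k (k + 1) z.1 = sumExtend r f ∧ (l2Coboundaries r k).mkQ z = h}

end L2

/-! ### The Garland poset, its link graph, and spectral gaps -/

section Garland

variable {P : Type u} [PartialOrder P]

/-- The poset of `k`- and `(k+1)`-faces above a `(k-1)`-face `p`, viewed as a graph: the vertices
are the `k`-faces, and two vertices are joined if they lie in a common `(k+1)`-face. Its connected
components are those of `P_{>p}^{k,k+1}`. -/
def linkGraph {k : ℕ} (p : Face P k) : SimpleGraph {b : Face P (k + 1) // p.1 < b.1} where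
  Adj b b' := b ≠ b' ∧ ∃ c : Face P (k + 1 + 1), b.1.1 < c.1 ∧ b'.1.1 < c.1
  symm := ⟨fun _ _ h => ⟨h.1.symm, h.2.imp fun _ hc => hc.symm⟩⟩
  loopless := ⟨fun _ h => h.1 rfl⟩

variable (P) in
/-- The elements of the Garland poset `S_k P`: `S^{-1}` consists of the connected components of the
links of the `(k-1)`-faces, `S^0 = P^k` and `S^1 = P^{k+1}`. -/
inductive GarlandPoset (k : ℕ) : Type u
  | low (p : Face P k) (C : (linkGraph p).ConnectedComponent) : GarlandPoset k
  | mid (b : Face P (k + 1)) : GarlandPoset k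
  | top (c : Face P (k + 1 + 1)) : GarlandPoset k

namespace GarlandPoset

/-- The strict order of `S_k P`: a component is below its vertices, and below the faces above
these; on `S^0 ∪ S^1` the order is that of `P`. -/
def slt {k : ℕ} : GarlandPoset P k → GarlandPoset P k → Prop
  | low p C, mid b => ∃ h : p.1 < b.1, (linkGraph p).connectedComponentMk ⟨b, h⟩ = C
  | low p C, top c => ∃ b : Face P (k + 1), ∃ h : p.1 < b.1,
      (linkGraph p).connectedComponentMk ⟨b, h⟩ = C ∧ b.1 < c.1
  | mid b, top c => b.1 < c.1
  | _, _ => False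

instance (k : ℕ) : PartialOrder (GarlandPoset P k) where
  le x y := x = y ∨ slt x y
  le_refl x := Or.inl rfl
  le_trans x y z := by
    rintro (rfl | h1) (rfl | h2)
    · exact Or.inl rfl
    · exact Or.inr h2
    · exact Or.inr h1
    · right
      cases x <;> cases y <;> cases z <;> simp only [slt] at h1 h2 ⊢
      obtain ⟨h, hC⟩ := h1
      exact ⟨_, h, hC, h2⟩
  le_antisymm x y := by
    rintro (rfl | h1) (h | h2)
    · rfl
    · rfl
    · exact h.symm
    · cases x <;> cases y <;> simp only [slt] at h1 h2

variable (P) in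
/-- `S^{-1}`. -/
abbrev Low (k : ℕ) : Type u := {a : GarlandPoset P k // ∃ p C, a = low p C}

/-- The vertices of the link graph at `a`: the elements of `S^0` above `a`. -/
def Vertex {k : ℕ} (a : Low P k) : Type u := {b : Face P (k + 1) // a.1 < mid b}

/-- The edges of the link graph at `a`: the elements of `S^1` above `a`. -/
def Edge {k : ℕ} (a : Low P k) : Type u := {c : Face P (k + 1 + 1) // a.1 < top c}

/-- The vertex `b` is an end of the edge `c`. -/
def Inc {k : ℕ} {a : Low P k} (b : Vertex a) (c : Edge a) : Prop :=
  (mid b.1 : GarlandPoset P k) < top c.1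

/-- The degree of a vertex in the link graph (a graph in which multiple edges may occur). -/
def degree {k : ℕ} {a : Low P k} (b : Vertex a) : ℕ := Nat.card {c : Edge a // Inc b c}

/-- The normalized graph Laplacian of the link graph at `a`: at the vertex `b` it is
`(1 / deg b) * ∑ (f b - f b')`, where the sum is over the edges at `b`, and `b'` is the other end.
(The term `b' = b` contributes `0`.) -/
def laplacian {k : ℕ} {a : Low P k} (f : Vertex a → ℝ) (b : Vertex a) : ℝ :=
  (∑ᶠ c : {c : Edge a // Inc b c}, ∑ᶠ b' : {b' : Vertex a // Inc b' c.1}, (f b - f b'.1)) /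
    (degree b : ℝ)

/-- The eigenvalues of the normalized graph Laplacian of the link graph at `a`. -/
def laplacianEigenvalues {k : ℕ} (a : Low P k) : Set ℝ :=
  {μ | ∃ f : Vertex a → ℝ, f ≠ 0 ∧ ∀ b, laplacian f b = μ * f b}

/-- The spectral gap of the link graph at `a` (a connected component of the link graph of `S_k P`):
the smallest non-zero eigenvalue of its normalized Laplacian; it is `⊤` if there is none, i.e. if
the graph has no edges. -/
def spectralGap {k : ℕ} (a : Low P k) : EReal :=
  ⨅ μ ∈ {μ ∈ laplacianEigenvalues a | μ ≠ 0}, (μ : EReal)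

end GarlandPoset

end Garland

end SimplicialPoset

end

/-! This is Garland's method in Hilbert space form. A square-summable `k`-cocycle `φ` is localized
at each `(k-1)`-face `p` to the function `[p:b] φ(b)` on the vertices of the link graph of `p`. A
`k`-face has `k + 1` facets, so the weighted squared norms of the localizations add up to `(k + 1)
‖φ‖²` (`hasSum_localize`). Two facets of a `(k+1)`-face `c` meet in exactly one `(k-1)`-face, so the
Dirichlet energies of the localizations split over the faces `c`; by the sign rule of the diamond
the share of `c` is `(dφ(c))²` plus `k` times the sum of `φ(b)²` over its facets (`sum_pairs`).
Since `dφ = 0`, the energies add up to at most `k ‖φ‖²` (`sum_incEnergy_le`). Hence the threshold `k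
/ (k + 1)`.

If `φ` is orthogonal to all cocycles coming from links, each localization is orthogonal to the
locally constant functions, and by the spectral gap each non-zero one has energy larger than `k / (k
+ 1)` times its squared norm. The two sums then contradict each other unless `φ = 0`. So the
cocycles from links span a dense subspace, which gives the Hausdorff statement, and the finite one
because finite-dimensional subspaces are closed.

With a uniform gap `γ > k / (k + 1)`, the part of the localization orthogonal to the locally
constant families has squared norm at most `(k / γ) ‖φ‖²`. The projection of the localization to
these families is therefore bounded below (`projectedLocalization_lower_bound`), so its adjoint is
surjective; this adjoint is the sum of the maps `λ_p` (`adjoint_projectedLocalization_apply`).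

If the link graph of `p` is connected, a locally constant function on it is a constant `t`, and its
image is the coboundary of `t` times the indicator of `p`. The inequality `weight_le_sum_weight`
keeps the resulting primitives square-summable. -/

noncomputable section

open scoped Classical

namespace SimplicialPoset

universe u

/-! ### Spectral gaps of weighted symmetric operators on finite sets -/

/-- If `Q` is symmetric and all non-zero eigenvalues of `w⁻¹ Q` are larger than `β`, then the
quadratic form of `Q` exceeds `β` times the `w`-norm on the `w`-orthogonal complement of the
kernel. -/
theorem weighted_spectral_gap {V : Type*} [Fintype V] (w : V → ℝ) (hw : ∀ v, 0 < w v)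
    (Q : (V → ℝ) →ₗ[ℝ] (V → ℝ)) (hQ : ∀ f g, ∑ v, f v * Q g v = ∑ v, Q f v * g v) (β : ℝ)
    (hβ : ∀ μ : ℝ, μ ≠ 0 → ∀ f : V → ℝ, f ≠ 0 → (∀ v, Q f v = μ * (w v * f v)) → β < μ)
    (f : V → ℝ) (hf : f ≠ 0) (hperp : ∀ g, Q g = 0 → ∑ v, w v * (g v * f v) = 0) :
    β * ∑ v, w v * f v ^ 2 < ∑ v, f v * Q f v := by
  set s : V → ℝ := fun v => √(w v) with hs
  have hs0 : ∀ v, s v ≠ 0 := fun v => (Real.sqrt_pos.2 (hw v)).ne'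
  have hss : ∀ v, s v * s v = w v := fun v => Real.mul_self_sqrt (hw v).le
  -- Conjugation by `√w` replaces `w⁻¹ Q`, self-adjoint for the weighted product, by `w^(-1/2) Q
  -- w^(-1/2)`, symmetric for the standard one, so that the spectral theorem applies. Under it `f`
  -- becomes `√w f`.
  let A : EuclideanSpace ℝ V →ₗ[ℝ] EuclideanSpace ℝ V :=
    { toFun := fun x => WithLp.toLp 2 fun v => (s v)⁻¹ * Q (fun u => (s u)⁻¹ * x u) v
      map_add' := by
        intro x y
        ext v
        have : (fun u => (s u)⁻¹ * (x + y) u) =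
            (fun u => (s u)⁻¹ * x u) + fun u => (s u)⁻¹ * y u := by
          funext u; simp [mul_add]
        change (s v)⁻¹ * Q (fun u => (s u)⁻¹ * (x + y) u) v = _
        rw [this, map_add, Pi.add_apply, mul_add]
        rfl
      map_smul' := by
        intro t x
        ext v
        have : (fun u => (s u)⁻¹ * (t • x) u) = t • fun u => (s u)⁻¹ * x u := by
          funext u; simp [mul_left_comm]
        change (s v)⁻¹ * Q (fun u => (s u)⁻¹ * (t • x) u) v = _
        rw [this, map_smul, Pi.smul_apply, smul_eq_mul, mul_left_comm]
        rfl }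
  have hAapp : ∀ x v, A x v = (s v)⁻¹ * Q (fun u => (s u)⁻¹ * x u) v := fun x v => rfl
  have hinner : ∀ x y : EuclideanSpace ℝ V, inner ℝ x y = ∑ v, x v * y v := by
    intro x y
    simp [PiLp.inner_apply, mul_comm]
  have hA : A.IsSymmetric := by
    intro x y
    rw [hinner, hinner]
    have := hQ (fun u => (s u)⁻¹ * x u) (fun u => (s u)⁻¹ * y u)
    calc _ = ∑ v, Q (fun u => (s u)⁻¹ * x u) v * ((s v)⁻¹ * y v) :=
          Finset.sum_congr rfl fun v _ => by rw [hAapp]; ring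
      _ = ∑ v, (s v)⁻¹ * x v * Q (fun u => (s u)⁻¹ * y u) v := this.symm
      _ = _ := Finset.sum_congr rfl fun v _ => by rw [hAapp]; ring
  let x : EuclideanSpace ℝ V := WithLp.toLp 2 fun v => s v * f v
  have hxapp : ∀ v, x v = s v * f v := fun v => rfl
  have hxf : (fun u => (s u)⁻¹ * x u) = f := by
    funext u; rw [hxapp, inv_mul_cancel_left₀ (hs0 u)]
  let e := hA.eigenvectorBasis rfl
  let l := hA.eigenvalues rfl
  have hAe : ∀ i, A (e i) = l i • e i := fun i =>
    hA.apply_eigenvectorBasis rfl i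
  have hev : ∀ i v, Q (fun u => (s u)⁻¹ * e i u) v = l i * (w v * ((s v)⁻¹ * e i v)) := by
    intro i v
    have h1 : A (e i) v = l i * e i v := by rw [hAe]; simp
    rw [hAapp] at h1
    have h2 : Q (fun u => (s u)⁻¹ * e i u) v = s v * (l i * e i v) := by
      rw [← h1, mul_inv_cancel_left₀ (hs0 v)]
    rw [h2, ← hss v]
    have := hs0 v
    field_simp
  have hgne : ∀ i, (fun u => (s u)⁻¹ * e i u) ≠ 0 := by
    intro i h
    have h1 : e i ≠ 0 := e.orthonormal.ne_zero i
    apply h1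
    ext v
    have := congrFun h v
    simpa [hs0 v] using this
  -- An eigenvector with eigenvalue `0` comes from the kernel of `Q`, hence is orthogonal to `x`;
  -- only non-zero eigenvalues contribute to the expansion of `x`.
  have hterm : ∀ i, inner ℝ (e i) x ≠ 0 → β < l i := by
    intro i hi
    by_cases hl : l i = 0
    · exfalso
      apply hi
      rw [hinner]
      have h1 := hperp (fun u => (s u)⁻¹ * e i u) (by
        funext v; rw [hev, hl]; simp)
      rw [← h1]
      refine Finset.sum_congr rfl fun v _ => ?_
      rw [hxapp, ← hss v]
      have := hs0 v
      field_simp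
    · exact hβ _ hl _ (hgne i) (hev i)
  have hE : ∑ v, f v * Q f v = ∑ i, l i * inner ℝ (e i) x ^ 2 := by
    have h1 : ∑ v, f v * Q f v = inner ℝ x (A x) := by
      rw [hinner]
      refine Finset.sum_congr rfl fun v _ => ?_
      rw [hAapp, hxapp, hxf]
      have := hs0 v
      field_simp
    rw [h1, ← e.sum_inner_mul_inner x (A x)]
    refine Finset.sum_congr rfl fun i _ => ?_
    rw [← hA (e i) x, hAe, real_inner_comm, real_inner_smul_left]
    ring
  have hN : ∑ v, w v * f v ^ 2 = ∑ i, inner ℝ (e i) x ^ 2 := by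
    have h1 : ∑ v, w v * f v ^ 2 = inner ℝ x x := by
      rw [hinner]
      refine Finset.sum_congr rfl fun v _ => ?_
      rw [hxapp, ← hss v]
      ring
    rw [h1, ← e.sum_inner_mul_inner x x]
    refine Finset.sum_congr rfl fun i _ => ?_
    rw [real_inner_comm x (e i)]
    ring
  have hx : x ≠ 0 := by
    intro h
    apply hf
    funext v
    have : x v = 0 := by rw [h]; rfl
    rw [hxapp] at this
    exact (mul_eq_zero.1 this).resolve_left (hs0 v)
  obtain ⟨i, hi⟩ : ∃ i, inner ℝ (e i) x ≠ 0 := by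
    by_contra! h
    apply hx
    rw [← e.sum_repr' x]
    simp [h]
  rw [hE, hN, Finset.mul_sum]
  refine Finset.sum_lt_sum (fun j _ => ?_) ⟨i, Finset.mem_univ i, ?_⟩
  · by_cases hj : inner ℝ (e j) x = 0
    · simp [hj]
    · exact mul_le_mul_of_nonneg_right (hterm j hj).le (sq_nonneg _)
  · exact mul_lt_mul_of_pos_right (hterm i hi) (by positivity)

/-! ### Finite multigraphs given by an incidence relation -/

section Multigraph

variable {V C : Type*} [Fintype V] [Fintype C] (inc : V → C → Prop)

/-- The (unnormalized) Laplacian of a multigraph with vertices `V` and edges `C`. -/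
def incLaplacian : (V → ℝ) →ₗ[ℝ] (V → ℝ) where
  toFun f v := ∑ c, ∑ v', if inc v c ∧ inc v' c then f v - f v' else 0
  map_add' f g := by
    funext v
    simp only [Pi.add_apply, ← Finset.sum_add_distrib]
    refine Finset.sum_congr rfl fun c _ => Finset.sum_congr rfl fun v' _ => ?_
    split_ifs <;> ring
  map_smul' t f := by
    funext v
    simp only [Pi.smul_apply, smul_eq_mul, Finset.mul_sum, RingHom.id_apply]
    refine Finset.sum_congr rfl fun c _ => Finset.sum_congr rfl fun v' _ => ?_
    split_ifs <;> ring

/-- The Dirichlet energy of a function on the vertices of a multigraph. -/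
def incEnergy (f : V → ℝ) : ℝ :=
  ∑ c, (∑ v, ∑ v', if inc v c ∧ inc v' c then (f v - f v') ^ 2 else 0) / 2

/-- Summation by parts: average the sum with the one in which the two ends of each edge are
exchanged. The factor `1 / 2` is there because ends are taken as ordered pairs; the diagonal
contributes nothing. -/
theorem sum_mul_incLaplacian (f g : V → ℝ) : ∑ v, f v * incLaplacian inc g v =
    ∑ c, (∑ v, ∑ v', if inc v c ∧ inc v' c then (f v - f v') * (g v - g v') else 0) / 2 := by
  have h1 : ∑ v, f v * incLaplacian inc g v =
      ∑ c, ∑ v, ∑ v', if inc v c ∧ inc v' c then f v * (g v - g v') else 0 := by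
    rw [Finset.sum_comm]
    refine Finset.sum_congr rfl fun v _ => ?_
    simp only [incLaplacian, LinearMap.coe_mk, AddHom.coe_mk, Finset.mul_sum, mul_ite, mul_zero]
  rw [h1]
  refine Finset.sum_congr rfl fun c _ => ?_
  have h2 : (∑ v, ∑ v', if inc v c ∧ inc v' c then f v * (g v - g v') else 0) =
      ∑ v, ∑ v', if inc v c ∧ inc v' c then f v' * (g v' - g v) else 0 := by
    rw [Finset.sum_comm]
    simp only [and_comm]
  rw [eq_div_iff two_ne_zero, mul_two]
  nth_rewrite 2 [h2]
  simp only [← Finset.sum_add_distrib]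
  refine Finset.sum_congr rfl fun v _ => Finset.sum_congr rfl fun v' _ => ?_
  split_ifs <;> ring

theorem incLaplacian_symm (f g : V → ℝ) :
    ∑ v, f v * incLaplacian inc g v = ∑ v, incLaplacian inc f v * g v := by
  simp only [mul_comm (incLaplacian inc f _)]
  rw [sum_mul_incLaplacian, sum_mul_incLaplacian]
  simp only [mul_comm]

theorem sum_mul_incLaplacian_self (f : V → ℝ) :
    ∑ v, f v * incLaplacian inc f v = incEnergy inc f := by
  rw [sum_mul_incLaplacian, incEnergy]
  simp only [sq]

/-- Locally constant functions. -/
def LocConst (f : V → ℝ) : Prop := ∀ v v' c, inc v c → inc v' c → f v = f v'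

variable {inc}

/-- The energy of `f` vanishes, and it is a sum of squares. This direction suffices: orthogonality
to the locally constant functions implies orthogonality to the kernel. -/
theorem locConst_of_incLaplacian_eq_zero {f : V → ℝ} (hf : incLaplacian inc f = 0) :
    LocConst inc f := by
  have h : incEnergy inc f = 0 := by
    rw [← sum_mul_incLaplacian_self, hf]; simp
  intro v v' c hv hv'
  have h0 : ∀ c v v', 0 ≤ if inc v c ∧ inc v' c then (f v - f v') ^ 2 else 0 := by
    intro c v v'; split_ifs <;> positivity
  rw [incEnergy, Finset.sum_eq_zero_iff_of_nonneg fun c _ =>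
    div_nonneg (Finset.sum_nonneg fun v _ => Finset.sum_nonneg fun v' _ => h0 c v v')
      zero_le_two] at h
  have h1 := h c (Finset.mem_univ c)
  rw [div_eq_zero_iff, or_iff_left two_ne_zero, Finset.sum_eq_zero_iff_of_nonneg fun v _ =>
    Finset.sum_nonneg fun v' _ => h0 c v v'] at h1
  have h2 := h1 v (Finset.mem_univ v)
  rw [Finset.sum_eq_zero_iff_of_nonneg fun v' _ => h0 c v v'] at h2
  have h3 := h2 v' (Finset.mem_univ v')
  rw [if_pos ⟨hv, hv'⟩] at h3
  exact sub_eq_zero.1 (pow_eq_zero_iff two_ne_zero |>.1 h3)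

theorem LocConst.incEnergy_sub {g : V → ℝ} (hg : LocConst inc g) (f : V → ℝ) :
    incEnergy inc (f - g) = incEnergy inc f := by
  unfold incEnergy
  refine Finset.sum_congr rfl fun c _ => ?_
  congr 1
  refine Finset.sum_congr rfl fun v _ => Finset.sum_congr rfl fun v' _ => ?_
  split_ifs with h
  · rw [Pi.sub_apply, Pi.sub_apply, hg v v' c h.1 h.2]; ring
  · rfl

/-- The Poincaré inequality for functions orthogonal to the locally constant ones. -/
theorem poincare_of_perp {w : V → ℝ} (hw : ∀ v, 0 < w v) {β : ℝ}
    (hβ : ∀ μ : ℝ, μ ≠ 0 → ∀ f : V → ℝ, f ≠ 0 →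
      (∀ v, incLaplacian inc f v = μ * (w v * f v)) → β < μ)
    {f : V → ℝ} (hf : f ≠ 0) (hperp : ∀ g, LocConst inc g → ∑ v, w v * (g v * f v) = 0) :
    β * ∑ v, w v * f v ^ 2 < incEnergy inc f := by
  rw [← sum_mul_incLaplacian_self]
  exact weighted_spectral_gap w hw _ (incLaplacian_symm inc) β hβ f hf
    fun g hg => hperp g (locConst_of_incLaplacian_eq_zero hg)

end Multigraph

/-! ### Incidences between faces -/

section Faces

variable {P : Type u} [PartialOrder P] [OrderBot P]

theorem IsSimplicial.encard_of_covBy (hP : IsSimplicial P) {x y : P} {n : ℕ}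
    (hx : {z : P | z ⋖ x}.encard = n) (h : x ⋖ y) :
    {z : P | z ⋖ y}.encard = ((n + 1 : ℕ) : ℕ∞) := by
  obtain ⟨N, G, hG⟩ := hP.exists_embedding y
  have hy := embedding_univ hG
  obtain ⟨s, rfl, -⟩ := embedding_exists hG (h.le.trans hy.ge)
  rw [← hy] at h ⊢
  rw [embedding_covBy hG, Finset.covBy_iff_exists_insert] at h
  obtain ⟨i, hi, h⟩ := h
  rw [embedding_encard hG] at hx
  rw [embedding_encard hG, ← h, Finset.card_insert_of_notMem hi, Nat.cast_injective hx]

theorem IsSimplicial.encard_of_covBy' (hP : IsSimplicial P) {x y : P} {n : ℕ}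
    (hy' : {z : P | z ⋖ y}.encard = ((n + 1 : ℕ) : ℕ∞)) (h : x ⋖ y) :
    {z : P | z ⋖ x}.encard = n := by
  obtain ⟨N, G, hG⟩ := hP.exists_embedding y
  have hy := embedding_univ hG
  obtain ⟨s, rfl, -⟩ := embedding_exists hG (h.le.trans hy.ge)
  rw [← hy] at h hy'
  rw [embedding_covBy hG, Finset.covBy_iff_exists_insert] at h
  obtain ⟨i, hi, h⟩ := h
  rw [embedding_encard hG, ← h, Finset.card_insert_of_notMem hi] at hy'
  have := Nat.cast_injective hy'
  rw [embedding_encard hG]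
  norm_cast
  omega

/-- Bridges the Garland poset and its link graphs, which use `<`, and the cochain complex, which
uses `⋖`. -/
theorem IsSimplicial.covBy_iff_lt (hP : IsSimplicial P) {n : ℕ} {x : Face P n}
    {y : Face P (n + 1)} : x.1 ⋖ y.1 ↔ x.1 < y.1 := by
  refine ⟨fun h => h.lt, fun h => ?_⟩
  obtain ⟨N, G, hG⟩ := hP.exists_embedding y.1
  have hy := embedding_univ hG
  obtain ⟨s, hs, -⟩ := embedding_exists hG (h.le.trans hy.ge)
  have h1 := x.2
  have h2 := y.2
  rw [← hs, embedding_encard hG] at h1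
  rw [← hy, embedding_encard hG] at h2
  rw [← hs, ← hy, embedding_covBy hG, Finset.covBy_iff_card_sdiff_eq_one]
  refine ⟨Finset.subset_univ _, ?_⟩
  rw [Finset.card_sdiff_of_subset (Finset.subset_univ _), Nat.cast_injective h1,
    Nat.cast_injective h2]
  omega

theorem Face.not_le_of_lt {n m : ℕ} (hP : IsSimplicial P) (h : n < m) (x : Face P n)
    (y : Face P m) : ¬ y.1 ≤ x.1 := by
  intro hle
  obtain ⟨N, G, hG⟩ := hP.exists_embedding x.1
  have hx := embedding_univ hG
  obtain ⟨s, hs, -⟩ := embedding_exists hG (hle.trans hx.ge)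
  have h1 := x.2
  have h2 := y.2
  rw [← hx, embedding_encard hG] at h1
  rw [← hs, embedding_encard hG] at h2
  have := Finset.card_le_card (Finset.subset_univ s)
  rw [Nat.cast_injective h1, Nat.cast_injective h2] at this
  omega

theorem IsSimplicial.card_facets (hP : IsSimplicial P) {n : ℕ} (x : Face P (n + 1)) :
    (facets x).card = n + 1 := by
  have h : {y : P | y ⋖ x.1} = (fun y : Face P n => y.1) '' (facets x : Set (Face P n)) := by
    ext y
    simp only [Set.mem_ofPred_eq, Set.mem_image, Finset.mem_coe, mem_facets]
    constructor
    · intro hy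
      exact ⟨⟨y, hP.encard_of_covBy' x.2 hy⟩, hy, rfl⟩
    · rintro ⟨y, hy, rfl⟩
      exact hy
  have h1 := x.2
  have hinj : Function.Injective fun y : Face P n => y.1 := Subtype.val_injective
  rw [h, hinj.injOn.encard_image, Set.encard_coe_eq_coe_finsetCard] at h1
  exact Nat.cast_injective h1

theorem sgn_mul_self (r : P → P → Prop) (x y : P) : sgn r x y * sgn r x y = 1 := by
  unfold sgn
  rw [← mul_pow]
  simp

theorem sgn_sq (r : P → P → Prop) (x y : P) : sgn r x y ^ 2 = 1 := by
  rw [sq, sgn_mul_self]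

/-- The relation `d² = 0` on the diamond from `p` to `c`, rearranged using that signs square to `1`.
It turns differences of localized values at `p` into sums of signed values at `c`. -/
theorem IsSimplicial.sgn_mul_sgn (hP : IsSimplicial P) (r : P → P → Prop) [IsStrictTotalOrder P r]
    {k : ℕ} {p : Face P k} {b b' : Face P (k + 1)} {c : Face P (k + 1 + 1)} (hne : b ≠ b')
    (hb : p.1 ⋖ b.1) (hb' : p.1 ⋖ b'.1) (hc : b.1 ⋖ c.1) (hc' : b'.1 ⋖ c.1) :
    sgn r p.1 b.1 * sgn r p.1 b'.1 = -(sgn r b.1 c.1 * sgn r b'.1 c.1) := by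
  have key : sgn r p.1 b.1 * sgn r b.1 c.1 = -(sgn r p.1 b'.1 * sgn r b'.1 c.1) := by
    obtain ⟨x, y, -, h1, -, -, -, -, -, hs⟩ := hP.diamond r p c (hb.le.trans hc.le)
    have hne' : b.1 ≠ b'.1 := fun h => hne (Subtype.ext h)
    rcases (h1 _ hb).1 hc.le with h | h <;> rcases (h1 _ hb').1 hc'.le with h' | h'
    · exact absurd (h.trans h'.symm) hne'
    · rw [h, h', hs]
    · rw [h, h', hs, neg_neg]
    · exact absurd (h.trans h'.symm) hne'
  have e1 := sgn_mul_self r p.1 b'.1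
  have e2 := sgn_mul_self r b.1 c.1
  linear_combination (sgn r p.1 b'.1 * sgn r b.1 c.1) * key
    - (sgn r p.1 b.1 * sgn r p.1 b'.1) * e2 - (sgn r b.1 c.1 * sgn r b'.1 c.1) * e1

/-- `P` need not be a lattice, but everything below `c` lies in a Boolean lattice, where `b` and
`b'` each omit one vertex and the common facet omits both. -/
theorem IsSimplicial.existsUnique_inf (hP : IsSimplicial P) {k : ℕ} {b b' : Face P (k + 1)}
    {c : Face P (k + 1 + 1)} (hne : b ≠ b') (hc : b.1 ⋖ c.1) (hc' : b'.1 ⋖ c.1) :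
    ∃! p : Face P k, p.1 ⋖ b.1 ∧ p.1 ⋖ b'.1 := by
  obtain ⟨N, G, hG⟩ := hP.exists_embedding c.1
  have hy := embedding_univ hG
  obtain ⟨s, hs, -⟩ := embedding_exists hG (hc.le.trans hy.ge)
  obtain ⟨t, ht, -⟩ := embedding_exists hG (hc'.le.trans hy.ge)
  have hst : s ≠ t := fun h => hne (Subtype.ext (by rw [← hs, ← ht, h]))
  have hbb := b.2
  rw [← hs] at hbb hc
  rw [← ht, ← hy] at hc'
  rw [← hy] at hc
  rw [embedding_covBy hG, Finset.covBy_iff_exists_erase] at hc hc'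
  obtain ⟨i, -, rfl⟩ := hc
  obtain ⟨j, -, rfl⟩ := hc'
  have hij : i ≠ j := fun h => hst (by rw [h])
  have h1 : G ((Finset.univ.erase i).erase j) ⋖ b.1 := by
    rw [← hs, embedding_covBy hG, Finset.covBy_iff_exists_erase]
    exact ⟨j, by simp [hij.symm], rfl⟩
  have h2 : G ((Finset.univ.erase i).erase j) ⋖ b'.1 := by
    rw [← ht, embedding_covBy hG, Finset.covBy_iff_exists_erase]
    exact ⟨i, by simp [hij], by rw [Finset.erase_right_comm]⟩
  refine ⟨⟨_, hP.encard_of_covBy' b.2 h1⟩, ⟨h1, h2⟩, ?_⟩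
  rintro q ⟨hq, hq'⟩
  apply Subtype.ext
  rw [← hs] at hq
  obtain ⟨u, hu, -⟩ := embedding_exists hG hq.le
  rw [← ht] at hq'
  rw [← hu] at hq hq' ⊢
  have h3 : u ⊆ (Finset.univ.erase i).erase j := by
    intro x hx
    have hx1 := G.le_iff_le.1 hq.le hx
    have hx2 := G.le_iff_le.1 hq'.le hx
    simp at hx1 hx2 ⊢
    tauto
  rw [embedding_covBy hG] at hq
  have h4 : (Finset.univ.erase i).erase j ⊂ Finset.univ.erase i :=
    Finset.erase_ssubset (by simp [hij.symm])
  rcases h3.eq_or_ssubset with h | h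
  · rw [h]
  · exact absurd h4 (hq.2 h)

/-- The sum of a function over pairs of distinct facets of `c`, arranged by their
intersections. -/
theorem IsSimplicial.sum_pairs (hP : IsSimplicial P) (r : P → P → Prop) [IsStrictTotalOrder P r]
    {k : ℕ} (c : Face P (k + 1 + 1)) (φ : Cochain P (k + 1)) (T : Finset (Face P k))
    (hT : ∀ b ∈ facets c, facets b ⊆ T) :
    ∑ p ∈ T, (∑ b ∈ facets c, ∑ b' ∈ facets c, if p.1 ⋖ b.1 ∧ p.1 ⋖ b'.1 then
      (sgn r p.1 b.1 * φ b - sgn r p.1 b'.1 * φ b') ^ 2 else 0) / 2 =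
    coboundary r (k + 1) φ c ^ 2 + k * ∑ b ∈ facets c, φ b ^ 2 := by
  -- For `b ≠ b'` only their common facet contributes. For `b = b'` the left side is `0` while the
  -- square on the right is `4 φ(b)²`, hence the correction term.
  have h1 : ∀ b ∈ facets c, ∀ b' ∈ facets c, (∑ p ∈ T, if p.1 ⋖ b.1 ∧ p.1 ⋖ b'.1 then
      (sgn r p.1 b.1 * φ b - sgn r p.1 b'.1 * φ b') ^ 2 else 0) =
      (sgn r b.1 c.1 * φ b + sgn r b'.1 c.1 * φ b') ^ 2 - if b = b' then 4 * φ b ^ 2 else 0 := by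
    intro b hb b' hb'
    by_cases hbb : b = b'
    · subst hbb
      rw [if_pos rfl]
      have e := sgn_sq r b.1 c.1
      have : (∑ p ∈ T, if p.1 ⋖ b.1 ∧ p.1 ⋖ b.1 then
        (sgn r p.1 b.1 * φ b - sgn r p.1 b.1 * φ b) ^ 2 else 0) = 0 :=
        Finset.sum_eq_zero fun p _ => by simp
      rw [this]
      linear_combination (-4 * φ b ^ 2) * e
    · rw [if_neg hbb]
      obtain ⟨p, ⟨hp, hp'⟩, huniq⟩ :=
        hP.existsUnique_inf hbb (mem_facets.1 hb) (mem_facets.1 hb')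
      rw [Finset.sum_eq_single p]
      · rw [if_pos ⟨hp, hp'⟩]
        have e := hP.sgn_mul_sgn r hbb hp hp' (mem_facets.1 hb) (mem_facets.1 hb')
        have e1 := sgn_sq r p.1 b.1
        have e2 := sgn_sq r p.1 b'.1
        have e3 := sgn_sq r b.1 c.1
        have e4 := sgn_sq r b'.1 c.1
        linear_combination (-2 * φ b * φ b') * e + φ b ^ 2 * (e1 - e3) + φ b' ^ 2 * (e2 - e4)
      · intro q _ hq
        exact if_neg fun h => hq (huniq q h)
      · intro h
        exact absurd (hT b hb (mem_facets.2 hp)) h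
  have hcob : coboundary r (k + 1) φ c = ∑ b ∈ facets c, sgn r b.1 c.1 * φ b := rfl
  rw [← Finset.sum_div, Finset.sum_comm]
  -- Since `c` has `k + 2` facets, summing over `b` gives `(k + 2) + (k + 2) - 4 = 2k` as the
  -- coefficient of each `φ(b)²`, and the final halving leaves `k`.
  have h2 : ∀ b ∈ facets c, (∑ p ∈ T, ∑ b' ∈ facets c, if p.1 ⋖ b.1 ∧ p.1 ⋖ b'.1 then
      (sgn r p.1 b.1 * φ b - sgn r p.1 b'.1 * φ b') ^ 2 else 0) =
      (k + 2) * φ b ^ 2 + 2 * (sgn r b.1 c.1 * φ b) * coboundary r (k + 1) φ c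
        + ∑ b' ∈ facets c, φ b' ^ 2 - 4 * φ b ^ 2 := by
    intro b hb
    rw [Finset.sum_comm, Finset.sum_congr rfl (h1 b hb), Finset.sum_sub_distrib,
      Finset.sum_ite_eq, if_pos hb]
    congr 1
    have h3 : ∀ b' ∈ facets c, (sgn r b.1 c.1 * φ b + sgn r b'.1 c.1 * φ b') ^ 2 =
        φ b ^ 2 + 2 * (sgn r b.1 c.1 * φ b) * (sgn r b'.1 c.1 * φ b') + φ b' ^ 2 := by
      intro b' _
      have e3 := sgn_sq r b.1 c.1
      have e4 := sgn_sq r b'.1 c.1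
      linear_combination φ b ^ 2 * e3 + φ b' ^ 2 * e4
    rw [Finset.sum_congr rfl h3, Finset.sum_add_distrib, Finset.sum_add_distrib,
      ← Finset.mul_sum, ← hcob, Finset.sum_const, hP.card_facets]
    push_cast [nsmul_eq_mul]
    ring
  rw [Finset.sum_congr rfl h2, Finset.sum_sub_distrib, Finset.sum_add_distrib,
    Finset.sum_add_distrib, ← Finset.mul_sum, ← Finset.mul_sum, ← Finset.sum_mul, ← Finset.mul_sum,
    ← hcob, Finset.sum_const, hP.card_facets]
  push_cast [nsmul_eq_mul]
  ring

end Faces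

/-! ### Link graphs -/

section LinkGraphs

variable {P : Type u} [PartialOrder P]

/-- The vertices of the link of `p`. -/
abbrev LinkV {k : ℕ} (p : Face P k) : Type u := {b : Face P (k + 1) // p.1 ⋖ b.1}

/-- The edges of the link of `p`. -/
abbrev LinkE {k : ℕ} (p : Face P k) : Type u := {c : Face P (k + 1 + 1) // p.1 < c.1}

/-- The incidence relation in the link of `p`. -/
def linkInc {k : ℕ} (p : Face P k) (b : LinkV p) (c : LinkE p) : Prop := b.1.1 ⋖ c.1.1

theorem GarlandPoset.low_lt_mid {k : ℕ} {p : Face P k} {C : (linkGraph p).ConnectedComponent}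
    {b : Face P (k + 1)} : low p C < mid b ↔
      ∃ h : p.1 < b.1, (linkGraph p).connectedComponentMk ⟨b, h⟩ = C := by
  constructor
  · rintro ⟨h | h, -⟩
    · cases h
    · exact h
  · intro h
    refine ⟨Or.inr h, ?_⟩
    rintro (h | h)
    · cases h
    · exact h

theorem GarlandPoset.low_lt_top {k : ℕ} {p : Face P k} {C : (linkGraph p).ConnectedComponent}
    {c : Face P (k + 1 + 1)} : low p C < top c ↔
      ∃ b : Face P (k + 1), ∃ h : p.1 < b.1,
        (linkGraph p).connectedComponentMk ⟨b, h⟩ = C ∧ b.1 < c.1 := by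
  constructor
  · rintro ⟨h | h, -⟩
    · cases h
    · exact h
  · intro h
    refine ⟨Or.inr h, ?_⟩
    rintro (h | h)
    · cases h
    · exact h

theorem GarlandPoset.mid_lt_top {k : ℕ} {b : Face P (k + 1)} {c : Face P (k + 1 + 1)} :
    (mid b : GarlandPoset P k) < top c ↔ b.1 < c.1 := by
  constructor
  · rintro ⟨h | h, -⟩
    · cases h
    · exact h
  · intro h
    refine ⟨Or.inr h, ?_⟩
    rintro (h | h)
    · cases h
    · exact h

/-- Puts the Laplacian into the shape of the numerator of `GarlandPoset.laplacian`, so that the two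
can be compared by bijections of index types. -/
theorem incLaplacian_eq_finsum {V C : Type*} [Fintype V] [Fintype C] (inc : V → C → Prop)
    (f : V → ℝ) (v : V) : incLaplacian inc f v =
      ∑ᶠ c : {c // inc v c}, ∑ᶠ v' : {v' // inc v' c.1}, (f v - f v'.1) := by
  simp only [finsum_eq_sum_of_fintype]
  have h1 : ∀ c, (∑ v' : {v' // inc v' c}, (f v - f v'.1)) =
      ∑ v', if inc v' c then f v - f v' else 0 := by
    intro c
    rw [← Finset.sum_filter]
    exact (Finset.sum_subtype _ (by simp) fun v' => f v - f v').symm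
  simp only [h1]
  rw [← Finset.sum_subtype (Finset.univ.filter (inc v)) (by simp)
    fun c => ∑ v', if inc v' c then f v - f v' else 0, Finset.sum_filter]
  refine Finset.sum_congr rfl fun c _ => ?_
  by_cases h : inc v c <;> simp [h]

variable [OrderBot P]

theorem finite_linkV (hL : IsLocallyFinite P) {k : ℕ} (hk : 1 ≤ k) (p : Face P k) :
    Finite (LinkV p) := by
  have h := (hL p.1 (p.ne_bot hk)).to_subtype
  refine Finite.of_injective (fun b : LinkV p => (⟨b.1.1, b.2.le⟩ : Set.Ici p.1)) fun b b' h => ?_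
  exact Subtype.ext (Subtype.ext (congrArg (fun x => x.1) h))

theorem finite_linkE (hL : IsLocallyFinite P) {k : ℕ} (hk : 1 ≤ k) (p : Face P k) :
    Finite (LinkE p) := by
  have h := (hL p.1 (p.ne_bot hk)).to_subtype
  refine Finite.of_injective (fun b : LinkE p => (⟨b.1.1, b.2.le⟩ : Set.Ici p.1)) fun b b' h => ?_
  exact Subtype.ext (Subtype.ext (congrArg (fun x => x.1) h))

/-- A lower bound for the spectral gaps of the components of the link graph of `p` bounds the
non-zero eigenvalues of the Laplacian of the whole link graph. -/
theorem lt_of_incLaplacian_eq (hP : IsSimplicial P) {k : ℕ} (p : Face P k) [Fintype (LinkV p)]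
    [Fintype (LinkE p)] {β : ℝ}
    (hβ : ∀ a : GarlandPoset.Low P k, (β : EReal) < GarlandPoset.spectralGap a)
    (μ : ℝ) (hμ : μ ≠ 0) (f : LinkV p → ℝ) (hf : f ≠ 0)
    (h : ∀ v, incLaplacian (linkInc p) f v = μ * (weight k v.1.1 * f v)) : β < μ := by
  obtain ⟨v₀, hv₀⟩ : ∃ v, f v ≠ 0 := by
    by_contra! h0
    exact hf (funext h0)
  -- The eigenfunction is restricted to the component of a vertex where it does not vanish. No edge
  -- leaves a component, so the restriction is a non-zero eigenfunction of that component.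
  let C := (linkGraph p).connectedComponentMk ⟨v₀.1, v₀.2.lt⟩
  let a : GarlandPoset.Low P k := ⟨GarlandPoset.low p C, p, C, rfl⟩
  have hcov : ∀ b : GarlandPoset.Vertex a, p.1 ⋖ b.1.1 := fun b =>
    hP.covBy_iff_lt.2 (GarlandPoset.low_lt_mid.1 b.2).1
  let v : GarlandPoset.Vertex a → LinkV p := fun b => ⟨b.1, hcov b⟩
  have hvinj : Function.Injective v := fun b b' h =>
    Subtype.ext (congrArg (fun x => x.1) h)
  let g : GarlandPoset.Vertex a → ℝ := fun b => f (v b)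
  have hg : g ≠ 0 := fun h0 =>
    hv₀ (congrFun h0 ⟨v₀.1, GarlandPoset.low_lt_mid.2 ⟨v₀.2.lt, rfl⟩⟩)
  have hinc : ∀ (b : GarlandPoset.Vertex a) (c : GarlandPoset.Edge a),
      GarlandPoset.Inc b c ↔ b.1.1 ⋖ c.1.1 := fun b c =>
    GarlandPoset.mid_lt_top.trans hP.covBy_iff_lt.symm
  have hElt : ∀ c : GarlandPoset.Edge a, p.1 < c.1.1 := by
    intro c
    obtain ⟨b, h1, -, h2⟩ := GarlandPoset.low_lt_top.1 c.2
    exact h1.trans h2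
  have hEof : ∀ (b : GarlandPoset.Vertex a) (c : Face P (k + 1 + 1)), b.1.1 ⋖ c.1 →
      a.1 < GarlandPoset.top c := by
    intro b c hbc
    obtain ⟨h1, h2⟩ := GarlandPoset.low_lt_mid.1 b.2
    exact GarlandPoset.low_lt_top.2 ⟨b.1, h1, h2, hbc.lt⟩
  have hVof : ∀ (b : GarlandPoset.Vertex a) (b' : LinkV p) (c : Face P (k + 1 + 1)),
      b.1.1 ⋖ c.1 → b'.1.1 ⋖ c.1 → a.1 < GarlandPoset.mid b'.1 := by
    intro b b' c hb hb'
    obtain ⟨h1, h2⟩ := GarlandPoset.low_lt_mid.1 b.2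
    refine GarlandPoset.low_lt_mid.2 ⟨b'.2.lt, ?_⟩
    rw [← h2]
    by_cases hbb : b'.1 = b.1
    · congr
    · refine SimpleGraph.ConnectedComponent.sound (SimpleGraph.Adj.reachable ?_)
      exact ⟨fun h => hbb (congrArg Subtype.val h), c, hb'.lt, hb.lt⟩
  have hlap : ∀ b, GarlandPoset.laplacian g b = μ * g b := by
    intro b
    have hnum : (∑ᶠ c : {c : GarlandPoset.Edge a // GarlandPoset.Inc b c},
        ∑ᶠ b' : {b' : GarlandPoset.Vertex a // GarlandPoset.Inc b' c.1}, (g b - g b'.1)) =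
        incLaplacian (linkInc p) f (v b) := by
      rw [incLaplacian_eq_finsum]
      refine finsum_eq_of_bijective
        (fun c => ⟨⟨c.1.1, hElt c.1⟩, (hinc b c.1).1 c.2⟩) ⟨?_, ?_⟩ fun c => ?_
      · intro c c' h
        exact Subtype.ext (Subtype.ext (congrArg (fun x => x.1.1) h))
      · rintro ⟨⟨c, hc⟩, hbc⟩
        exact ⟨⟨⟨c, hEof b c hbc⟩, (hinc b _).2 hbc⟩, rfl⟩
      · refine finsum_eq_of_bijective
          (fun b' => ⟨v b'.1, (hinc b'.1 c.1).1 b'.2⟩) ⟨?_, ?_⟩ fun b' => rfl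
        · intro b' b'' h
          exact Subtype.ext (hvinj (congrArg Subtype.val h))
        · rintro ⟨b', hb'⟩
          refine ⟨⟨⟨b'.1, hVof b b' c.1.1 ((hinc b c.1).1 c.2) hb'⟩, ?_⟩, rfl⟩
          exact (hinc _ c.1).2 hb'
    have hdeg : GarlandPoset.degree b = {c : Face P (k + 1 + 1) | b.1.1 ≤ c.1}.ncard := by
      refine Nat.card_congr ⟨fun c => ⟨c.1.1, ((hinc b c.1).1 c.2).le⟩, fun c =>
        have hc : b.1.1 ⋖ c.1.1 := hP.covBy_iff_lt.2 (lt_of_le_not_ge c.2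
          (Face.not_le_of_lt hP (Nat.lt_succ_self _) _ _))
        ⟨⟨c.1, hEof b c.1 hc⟩, (hinc b _).2 hc⟩, fun c => rfl, fun c => rfl⟩
    have hvb := h (v b)
    rw [GarlandPoset.laplacian, hnum]
    -- At an isolated vertex the normalized Laplacian is `0` by division by zero, whereas the weight
    -- is `1`. The eigenvalue equation with `μ ≠ 0` forces `f` to vanish there, so both sides agree.
    by_cases hd : GarlandPoset.degree b = 0
    · have hempty : IsEmpty {c : LinkE p // linkInc p (v b) c} := by
        constructor
        rintro ⟨c, hc⟩
        -- `Nat.card` is `0` on infinite types as well, so finiteness is needed to conclude that no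
        -- edge exists.
        have hfin : Finite {c : GarlandPoset.Edge a // GarlandPoset.Inc b c} :=
          Finite.of_injective (β := LinkE p) (fun c => ⟨c.1.1, hElt c.1⟩) fun c c' h =>
            Subtype.ext (Subtype.ext (congrArg (fun x => x.1) h))
        have : Nonempty {c : GarlandPoset.Edge a // GarlandPoset.Inc b c} :=
          ⟨⟨c.1, hEof b c.1 hc⟩, (hinc b _).2 hc⟩
        exact Nat.card_pos.ne' hd
      have h0 : incLaplacian (linkInc p) f (v b) = 0 := by
        rw [incLaplacian_eq_finsum, finsum_of_isEmpty]
      rw [h0] at hvb ⊢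
      have := (weight_pos k (v b).1.1).ne'
      have h1 : f (v b) = 0 := by
        rcases mul_eq_zero.1 hvb.symm with h | h
        · exact absurd h hμ
        · exact (mul_eq_zero.1 h).resolve_left this
      show 0 / _ = μ * f (v b)
      rw [h1]; simp
    · have hw : weight k (v b).1.1 = GarlandPoset.degree b := by
        rw [weight, hdeg]
        apply max_eq_right
        rw [hdeg] at hd
        exact_mod_cast Nat.one_le_iff_ne_zero.2 hd
      have hd' : (GarlandPoset.degree b : ℝ) ≠ 0 := by exact_mod_cast hd
      rw [hvb, hw, div_eq_iff hd']
      show μ * (_ * f (v b)) = μ * f (v b) * _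
      ring
  have h2 := (hβ a).trans_le (iInf₂_le μ ⟨⟨g, hg, hlap⟩, hμ⟩)
  exact_mod_cast h2

end LinkGraphs

/-! ### Cocycles of degree zero in links -/

section LinkCocycles

variable {P : Type u} [PartialOrder P] [OrderBot P]

/-- In the Boolean interval below `y`, the facets of `y` containing `p` are those omitting a vertex
outside `p`. Faces of the link thus become faces of `P` with `k` more vertices. -/
theorem IsSimplicial.link_encard (hP : IsSimplicial P) {k j : ℕ} (p : Face P k)
    (y : Set.Ici p.1) (hy : {z : Set.Ici p.1 | z ⋖ y}.encard = j) :
    {z : P | z ⋖ y.1}.encard = ((k + j : ℕ) : ℕ∞) := by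
  obtain ⟨N, G, hG⟩ := hP.exists_embedding y.1
  have hu := embedding_univ hG
  have hpy : p.1 ≤ y.1 := y.2
  obtain ⟨s, hs, -⟩ := embedding_exists hG (hpy.trans hu.ge)
  have h1 : Subtype.val '' {z : Set.Ici p.1 | z ⋖ y} =
      (fun i => G (Finset.univ.erase i)) '' ((sᶜ : Finset (Fin N)) : Set (Fin N)) := by
    ext z
    simp only [Set.mem_image, Set.mem_ofPred_eq, Finset.mem_coe, Finset.mem_compl]
    constructor
    · rintro ⟨z, hz, rfl⟩
      rw [link_covBy, ← hu] at hz
      obtain ⟨t, ht, -⟩ := embedding_exists hG hz.le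
      rw [← ht, embedding_covBy hG, Finset.covBy_iff_exists_erase] at hz
      obtain ⟨i, -, rfl⟩ := hz
      refine ⟨i, fun hi => ?_, ht⟩
      have hpz : G s ≤ G (Finset.univ.erase i) := by
        rw [hs, ht]
        exact z.2
      simpa using G.le_iff_le.1 hpz hi
    · rintro ⟨i, hi, rfl⟩
      have hle : p.1 ≤ G (Finset.univ.erase i) := by
        rw [← hs, G.le_iff_le]
        intro x hx
        rw [Finset.mem_erase]
        exact ⟨fun h => hi (h ▸ hx), Finset.mem_univ _⟩
      refine ⟨⟨_, hle⟩, ?_, rfl⟩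
      rw [link_covBy, ← hu, embedding_covBy hG, Finset.covBy_iff_exists_erase]
      exact ⟨i, Finset.mem_univ _, rfl⟩
  have hinj : Function.Injective fun i => G ((Finset.univ : Finset (Fin N)).erase i) := by
    intro i j hij
    by_contra hne
    have h2 : j ∈ Finset.univ.erase i := Finset.mem_erase.2 ⟨fun h => hne h.symm, Finset.mem_univ _⟩
    rw [G.injective hij] at h2
    simp at h2
  rw [← Subtype.val_injective.injOn.encard_image, h1, hinj.injOn.encard_image,
    Set.encard_coe_eq_coe_finsetCard] at hy
  have hy' := Nat.cast_injective hy
  have hp := p.2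
  rw [← hs, embedding_encard hG] at hp
  have hp' := Nat.cast_injective hp
  rw [← hu, embedding_encard hG]
  rw [Finset.card_compl] at hy'
  have := Finset.card_le_univ s
  rw [Finset.card_univ]
  norm_cast
  omega

/-- By the diamond property an edge of the link has only two ends, on which the link coboundary is a
difference up to sign. This identifies `0`-cocycles of the link with locally constant functions, in
both directions. -/
theorem IsSimplicial.link_edge (hP : IsSimplicial P) (r : P → P → Prop) [IsStrictTotalOrder P r]
    {k : ℕ} (p : Face P k) (c : LinkE p) :
    ∃ b b' : LinkV p, linkInc p b c ∧ linkInc p b' c ∧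
      (∀ v, linkInc p v c → v = b ∨ v = b') ∧
      {y : Set.Ici p.1 | y ⋖ (⟨c.1.1, c.2.le⟩ : Set.Ici p.1)}.encard = ((0 + 1 + 1 : ℕ) : ℕ∞) ∧
      ∀ C : Face (Set.Ici p.1) (0 + 1 + 1), C.1.1 = c.1.1 →
        ∃ ε : ℝ, ε ≠ 0 ∧ ∀ F, coboundary (linkOrder r p.1) (0 + 1) F C =
          ε * (F (linkVertex b.1 b.2) - F (linkVertex b'.1 b'.2)) := by
  have hpc := c.2.le
  obtain ⟨b, b', hne, h1, h2, hb, hb', hkb, hkb', hs⟩ := hP.diamond r p c.1 hpc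
  set B : Face P (k + 1) := ⟨b, hkb⟩ with hB
  set B' : Face P (k + 1) := ⟨b', hkb'⟩ with hB'
  have hlink : {y : Set.Ici p.1 | y ⋖ (⟨c.1.1, hpc⟩ : Set.Ici p.1)} =
      {⟨b, hb.le⟩, ⟨b', hb'.le⟩} := by
    ext y
    rw [Set.mem_ofPred_eq, link_covBy, h2 y.1 y.2]
    simp [Subtype.ext_iff]
  refine ⟨⟨B, hb⟩, ⟨B', hb'⟩, (h2 b hb.le).2 (Or.inl rfl), (h2 b' hb'.le).2 (Or.inr rfl),
    fun v hv => ?_, ?_, fun C hC => ?_⟩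
  · refine ((h2 v.1.1 v.2.le).1 hv).imp (fun h => ?_) fun h => ?_
    · exact Subtype.ext (Subtype.ext h)
    · exact Subtype.ext (Subtype.ext h)
  · rw [hlink, Set.encard_pair (by simpa [Subtype.ext_iff] using hne)]
    norm_num
  have hC1 : C.1 = ⟨c.1.1, hpc⟩ := Subtype.ext hC
  have hfac : facets C = {linkVertex B hb, linkVertex B' hb'} := by
    ext y
    rw [mem_facets, link_covBy, hC]
    rw [h2 y.1.1 y.1.2, Finset.mem_insert, Finset.mem_singleton]
    refine or_congr ⟨fun h => Subtype.ext (Subtype.ext h), fun h => ?_⟩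
      ⟨fun h => Subtype.ext (Subtype.ext h), fun h => ?_⟩
    · rw [h]; rfl
    · rw [h]; rfl
  have hvne : linkVertex B hb ≠ linkVertex B' hb' := by
    intro h
    exact hne (congrArg (fun y => y.1.1) h)
  have e1 : sgn (linkOrder r p.1) (linkVertex B hb).1 C.1 = if r b b' then -1 else 1 := by
    rw [hC1]
    exact link_sgn r hb hb' hne hpc h1
  have e2 : sgn (linkOrder r p.1) (linkVertex B' hb').1 C.1 = if r b' b then -1 else 1 := by
    rw [hC1]
    exact link_sgn r hb' hb hne.symm hpc (fun y hy => by rw [h1 y hy, or_comm])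
  refine ⟨if r b b' then -1 else 1, by split_ifs <;> norm_num, fun F => ?_⟩
  show ∑ y ∈ facets C, sgn (linkOrder r p.1) y.1 C.1 * F y = _
  rw [hfac, Finset.sum_pair hvne, e1, e2]
  rcases trichotomous_of r b b' with h | h | h
  · have h' : ¬ r b' b := asymm h
    rw [if_pos h, if_neg h']
    ring
  · exact absurd h hne
  · have h' : ¬ r b b' := asymm h
    rw [if_pos h, if_neg h']
    ring

theorem locConst_of_mem_cocycles (hP : IsSimplicial P) (r : P → P → Prop)
    [IsStrictTotalOrder P r] {k : ℕ} (p : Face P k) {F : Cochain (Set.Ici p.1) (0 + 1)}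
    (hF : F ∈ cocycles (linkOrder r p.1) 0) :
    LocConst (linkInc p) fun v : LinkV p => F (linkVertex v.1 v.2) := by
  intro v v' c hv hv'
  obtain ⟨b, b', -, -, hall, hcard, hC⟩ := hP.link_edge r p c
  obtain ⟨ε, hε, h⟩ := hC ⟨⟨c.1.1, c.2.le⟩, hcard⟩ rfl
  have h1 := h F
  rw [show coboundary (linkOrder r p.1) (0 + 1) F = 0 from hF] at h1
  have h2 : F (linkVertex b.1 b.2) = F (linkVertex b'.1 b'.2) :=
    sub_eq_zero.1 ((mul_eq_zero.1 h1.symm).resolve_left hε)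
  rcases hall v hv with rfl | rfl <;> rcases hall v' hv' with rfl | rfl
  · rfl
  · exact h2
  · exact h2.symm
  · rfl

/-- The vertex of the link of `p` given by a `0`-face of `Set.Ici p`. -/
def toLinkV (hP : IsSimplicial P) {k : ℕ} (p : Face P k) (y : Face (Set.Ici p.1) (0 + 1)) :
    LinkV p :=
  ⟨⟨y.1.1, hP.link_encard p y.1 y.2⟩, (hP.covBy_iff_lt (y := ⟨y.1.1, hP.link_encard p y.1 y.2⟩)).2
    (lt_of_le_not_ge y.1.2 (Face.not_le_of_lt hP (Nat.lt_succ_self _) p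
      ⟨y.1.1, hP.link_encard p y.1 y.2⟩))⟩

/-- A locally constant function on the link of `p`, as a cocycle of degree `0`. -/
def locConstCocycle (hP : IsSimplicial P) (r : P → P → Prop) [IsStrictTotalOrder P r] {k : ℕ}
    (p : Face P k) (f : LinkV p → ℝ) (hf : LocConst (linkInc p) f) :
    cocycles (linkOrder r p.1) 0 :=
  ⟨fun y => f (toLinkV hP p y), by
    rw [cocycles, LinearMap.mem_ker]
    funext C
    have hpc : p.1 < C.1.1 := lt_of_le_not_ge C.1.2 (Face.not_le_of_lt hP (by omega) p
      (⟨C.1.1, hP.link_encard p C.1 C.2⟩ : Face P (k + (0 + 1 + 1))))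
    have hC2 : {z : P | z ⋖ C.1.1}.encard = ((k + 1 + 1 : ℕ) : ℕ∞) := by
      rw [hP.link_encard p C.1 C.2]
    obtain ⟨b, b', hb, hb', -, -, hC⟩ := hP.link_edge r p ⟨⟨C.1.1, hC2⟩, hpc⟩
    obtain ⟨ε, -, h⟩ := hC C rfl
    rw [h]
    have : f (toLinkV hP p (linkVertex b.1 b.2)) = f (toLinkV hP p (linkVertex b'.1 b'.2)) :=
      hf b b' _ hb hb'
    simp [this]⟩

/-- If the link graph of `p` is connected, then the `0`-cocycles of the link are constant. -/
theorem exists_eq_const_of_preconnected (hP : IsSimplicial P) (r : P → P → Prop)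
    [IsStrictTotalOrder P r] {k : ℕ} (p : Face P k) (hp : (linkGraph p).Preconnected)
    {F : Cochain (Set.Ici p.1) (0 + 1)} (hF : F ∈ cocycles (linkOrder r p.1) 0) :
    ∃ t : ℝ, (∀ b : LinkV p, F (linkVertex b.1 b.2) = t) ∧ (IsEmpty (LinkV p) → t = 0) := by
  have hloc := locConst_of_mem_cocycles hP r p hF
  by_cases hne : Nonempty (LinkV p)
  · obtain ⟨b₀⟩ := hne
    refine ⟨F (linkVertex b₀.1 b₀.2), fun b => ?_, fun h => (h.false b₀).elim⟩
    have key : ∀ x y : {b : Face P (k + 1) // p.1 < b.1}, (linkGraph p).Reachable x y →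
        F (linkVertex x.1 (hP.covBy_iff_lt.2 x.2)) = F (linkVertex y.1 (hP.covBy_iff_lt.2 y.2)) := by
      rintro x y ⟨q⟩
      induction q with
      | nil => rfl
      | @cons x y z hxy _ ih =>
        rw [← ih]
        obtain ⟨-, c, hx, hy⟩ := hxy
        exact hloc ⟨x.1, hP.covBy_iff_lt.2 x.2⟩ ⟨y.1, hP.covBy_iff_lt.2 y.2⟩ ⟨c, x.2.trans hx⟩
          (hP.covBy_iff_lt.2 hx) (hP.covBy_iff_lt.2 hy)
    exact key ⟨b.1, b.2.lt⟩ ⟨b₀.1, b₀.2.lt⟩ (hp _ _)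
  · exact ⟨0, fun b => absurd ⟨b⟩ hne, fun _ => rfl⟩

end LinkCocycles

/-! ### The Hilbert space structure on square-summable cochains -/

section Hilbert

variable {P : Type u} [PartialOrder P]

/-- The norm is induced by `L2Cochain.toLp`; transporting the inner product along the same map makes
it compatible with that norm. -/
instance (k n : ℕ) : InnerProductSpace ℝ (L2Cochain P k n) where
  inner φ ψ := inner ℝ (L2Cochain.toLp k n φ) (L2Cochain.toLp k n ψ)
  norm_sq_eq_re_inner φ := norm_sq_eq_re_inner (𝕜 := ℝ) (L2Cochain.toLp k n φ)
  conj_inner_symm φ ψ := inner_conj_symm (L2Cochain.toLp k n φ) (L2Cochain.toLp k n ψ)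
  add_left φ ψ χ := by
    rw [map_add]
    exact inner_add_left _ _ _
  smul_left φ ψ t := by
    rw [map_smul]
    exact inner_smul_left _ _ _

theorem L2Cochain.toLp_apply {k n : ℕ} (φ : L2Cochain P k n) (x : Face P n) :
    L2Cochain.toLp k n φ x = √(weight k x.1) * L2Cochain.val k n φ x := rfl

theorem L2Cochain.isometry_toLp (k n : ℕ) : Isometry (L2Cochain.toLp (P := P) k n) :=
  AddMonoidHomClass.isometry_of_norm _ fun _ => rfl

/-- Dividing by `√weight` inverts the isometry. Completeness follows, and with it orthogonal
complements and adjoints become available. -/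
theorem L2Cochain.toLp_surjective (k n : ℕ) :
    Function.Surjective (L2Cochain.toLp (P := P) k n) := by
  intro g
  have hg : Summable fun x => g x ^ 2 := by
    have := (lp.memℓp g).summable (by norm_num)
    refine this.congr fun x => ?_
    simp
  have h0 : ∀ x : Face P n, √(weight k x.1) ≠ 0 := fun x =>
    (Real.sqrt_pos.2 (weight_pos k x.1)).ne'
  refine ⟨⟨fun x => g x / √(weight k x.1), ?_⟩, ?_⟩
  · refine hg.congr fun x => ?_
    rw [div_pow, Real.sq_sqrt (weight_pos k x.1).le, mul_div_cancel₀]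
    exact (weight_pos k x.1).ne'
  · ext x
    exact mul_div_cancel₀ _ (h0 x)

instance (k n : ℕ) : CompleteSpace (L2Cochain P k n) := by
  let e : L2Cochain P k n ≃ᵢ lp (fun _ : Face P n => ℝ) 2 :=
    ⟨Equiv.ofBijective _ ⟨L2Cochain.toLp_injective k n, L2Cochain.toLp_surjective k n⟩,
      L2Cochain.isometry_toLp k n⟩
  exact e.completeSpace

theorem L2Cochain.inner_eq_tsum {k n : ℕ} (φ ψ : L2Cochain P k n) : inner ℝ φ ψ =
    ∑' x : Face P n, weight k x.1 * (L2Cochain.val k n φ x * L2Cochain.val k n ψ x) := by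
  have h : inner ℝ φ ψ = inner ℝ (L2Cochain.toLp k n φ) (L2Cochain.toLp k n ψ) := rfl
  rw [h, lp.inner_eq_tsum]
  refine tsum_congr fun x => ?_
  rw [L2Cochain.toLp_apply, L2Cochain.toLp_apply]
  have := Real.mul_self_sqrt (weight_pos k x.1).le
  simp only [RCLike.inner_apply, conj_trivial]
  linear_combination (L2Cochain.val k n φ x * L2Cochain.val k n ψ x) * this

theorem L2Cochain.hasSum_norm_sq {k n : ℕ} (φ : L2Cochain P k n) :
    HasSum (fun x : Face P n => weight k x.1 * L2Cochain.val k n φ x ^ 2) (‖φ‖ ^ 2) := by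
  have h : Summable fun x : Face P n => weight k x.1 * L2Cochain.val k n φ x ^ 2 := φ.2
  rw [← real_inner_self_eq_norm_sq, L2Cochain.inner_eq_tsum]
  simp only [← sq]
  exact h.hasSum

theorem L2Cochain.continuous_val_apply {k n : ℕ} (x : Face P n) :
    Continuous fun φ : L2Cochain P k n => L2Cochain.val k n φ x := by
  have h1 : Continuous fun φ : L2Cochain P k n => L2Cochain.toLp k n φ x :=
    (lp.evalCLM ℝ (fun _ : Face P n => ℝ) 2 x).continuous.comp
      (L2Cochain.isometry_toLp k n).continuous
  have h0 := (Real.sqrt_pos.2 (weight_pos k x.1)).ne'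
  refine (h1.const_mul (√(weight k x.1))⁻¹).congr fun φ => ?_
  rw [L2Cochain.toLp_apply, inv_mul_cancel_left₀ h0]

theorem lp_hasSum_sq {X : Type*} (g : lp (fun _ : X => ℝ) 2) :
    HasSum (fun x => g x ^ 2) (‖g‖ ^ 2) := by
  have h : Summable fun x => g x ^ 2 := by
    refine ((lp.memℓp g).summable (by norm_num)).congr fun x => ?_
    simp
  rw [← real_inner_self_eq_norm_sq, lp.inner_eq_tsum]
  simpa [← sq] using h.hasSum

variable [OrderBot P]

/-- The coboundary at a face involves finitely many values of the cochain, each continuous in the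
`ℓ²` norm. Hence the cocycles form a Hilbert space. -/
theorem isClosed_l2Cocycles (r : P → P → Prop) (k : ℕ) :
    IsClosed (l2Cocycles (P := P) r k : Set (L2Cochain P k (k + 1))) := by
  have : (l2Cocycles (P := P) r k : Set (L2Cochain P k (k + 1))) =
      ⋂ c, {φ | ∑ y ∈ facets c, sgn r y.1 c.1 * L2Cochain.val k (k + 1) φ y = 0} := by
    ext φ
    rw [Set.mem_iInter]
    exact funext_iff
  rw [this]
  refine isClosed_iInter fun c => isClosed_eq ?_ continuous_const
  exact continuous_finsetSum _ fun y _ => (L2Cochain.continuous_val_apply y).const_mul _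

instance (r : P → P → Prop) (k : ℕ) : CompleteSpace (l2Cocycles (P := P) r k) :=
  (isClosed_l2Cocycles r k).completeSpace_coe

/-- Sums over incident pairs of a `(k-1)`-face and a `k`-face. -/
theorem IsSimplicial.hasSum_pairs (hP : IsSimplicial P) {k : ℕ} {h : Face P (k + 1) → ℝ}
    (h0 : ∀ b, 0 ≤ h b) {a : ℝ} (hs : HasSum h a) :
    HasSum (fun x : Σ p : Face P k, LinkV p => h x.2.1) ((k + 1) * a) := by
  -- Regrouped by the `k`-face `b`, the pairs have fibres of size `k + 1` and the summand is
  -- constant on each fibre.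
  let e : (Σ b : Face P (k + 1), {p : Face P k // p ∈ facets b}) ≃ Σ p : Face P k, LinkV p :=
    { toFun := fun x => ⟨x.2.1, x.1, mem_facets.1 x.2.2⟩
      invFun := fun x => ⟨x.2.1, x.1, mem_facets.2 x.2.2⟩
      left_inv := fun x => rfl
      right_inv := fun x => rfl }
  rw [← e.hasSum_iff]
  have hfib : ∀ b : Face P (k + 1),
      HasSum (fun _ : {p : Face P k // p ∈ facets b} => h b) ((k + 1) * h b) := by
    intro b
    have := hasSum_fintype fun _ : {p : Face P k // p ∈ facets b} => h b
    rw [Finset.sum_const, Finset.card_univ, Fintype.card_coe, hP.card_facets] at this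
    simpa using this
  have hsum : Summable fun x : (Σ b : Face P (k + 1), {p : Face P k // p ∈ facets b}) => h x.1 := by
    rw [summable_sigma_of_nonneg fun x => h0 x.1]
    refine ⟨fun b => (hfib b).summable, ?_⟩
    simp only [(hfib _).tsum_eq]
    exact (hs.mul_left _).summable
  have h1 := hsum.hasSum.sigma hfib
  have h2 := h1.unique (hs.mul_left ((k : ℝ) + 1))
  have h3 := hsum.hasSum
  rw [h2] at h3
  exact h3

end Hilbert

/-! ### The energies of the localizations of a cocycle -/

section Energy

variable {P : Type u} [PartialOrder P] [OrderBot P]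

/-- The function on the link of `p` which a cochain defines. -/
def localize (r : P → P → Prop) {k : ℕ} (φ : Cochain P (k + 1)) (p : Face P k) (v : LinkV p) : ℝ :=
  sgn r p.1 v.1.1 * φ v.1

theorem sum_linkV_eq {k : ℕ} (p : Face P k) [Fintype (LinkV p)] (c : Face P (k + 1 + 1))
    (h : Face P (k + 1) → ℝ) : (∑ v : LinkV p, if v.1.1 ⋖ c.1 then h v.1 else 0) =
      ∑ b ∈ facets c, if p.1 ⋖ b.1 then h b else 0 := by
  rw [← Finset.sum_filter, ← Finset.sum_filter]
  refine Finset.sum_bij (fun v _ => v.1) ?_ ?_ ?_ ?_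
  · intro v hv
    rw [Finset.mem_filter] at hv ⊢
    exact ⟨mem_facets.2 hv.2, v.2⟩
  · intro v _ v' _ h
    exact Subtype.ext h
  · intro b hb
    rw [Finset.mem_filter] at hb
    exact ⟨⟨b, hb.2⟩, Finset.mem_filter.2 ⟨Finset.mem_univ _, mem_facets.1 hb.1⟩, rfl⟩
  · intro v _
    rfl

/-- The inner sums run over facets of `c`, independently of `p`, so that the sums over `p` and `c`
can be interchanged. -/
theorem incEnergy_localize (r : P → P → Prop) {k : ℕ} (φ : Cochain P (k + 1)) (p : Face P k)
    [Fintype (LinkV p)] [Fintype (LinkE p)] :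
    incEnergy (linkInc p) (localize r φ p) = ∑ c : LinkE p,
      (∑ b ∈ facets c.1, ∑ b' ∈ facets c.1, if p.1 ⋖ b.1 ∧ p.1 ⋖ b'.1 then
        (sgn r p.1 b.1 * φ b - sgn r p.1 b'.1 * φ b') ^ 2 else 0) / 2 := by
  unfold incEnergy
  refine Finset.sum_congr rfl fun c _ => ?_
  congr 1
  have h1 : ∀ b : Face P (k + 1), (∑ v' : LinkV p, if v'.1.1 ⋖ c.1.1 then
      (sgn r p.1 b.1 * φ b - sgn r p.1 v'.1.1 * φ v'.1) ^ 2 else 0) =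
      ∑ b' ∈ facets c.1, if p.1 ⋖ b'.1 then
        (sgn r p.1 b.1 * φ b - sgn r p.1 b'.1 * φ b') ^ 2 else 0 := fun b =>
    sum_linkV_eq p c.1 fun b' => (sgn r p.1 b.1 * φ b - sgn r p.1 b'.1 * φ b') ^ 2
  have h2 := sum_linkV_eq p c.1 fun b => ∑ b' ∈ facets c.1, if p.1 ⋖ b'.1 then
        (sgn r p.1 b.1 * φ b - sgn r p.1 b'.1 * φ b') ^ 2 else 0
  calc _ = ∑ v : LinkV p, if v.1.1 ⋖ c.1.1 then ∑ b' ∈ facets c.1, if p.1 ⋖ b'.1 then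
        (sgn r p.1 v.1.1 * φ v.1 - sgn r p.1 b'.1 * φ b') ^ 2 else 0 else 0 := by
        refine Finset.sum_congr rfl fun v _ => ?_
        rw [← h1]
        by_cases hv : v.1.1 ⋖ c.1.1 <;> simp [linkInc, hv, localize]
    _ = _ := h2
    _ = _ := by
        refine Finset.sum_congr rfl fun b _ => ?_
        by_cases hb : p.1 ⋖ b.1 <;> simp [hb]

/-- The energies of the localizations of a cocycle `φ` add up to at most `k ‖φ‖²`. -/
theorem sum_incEnergy_le (hP : IsSimplicial P) (hL : IsLocallyFinite P) (r : P → P → Prop)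
    [IsStrictTotalOrder P r] {k : ℕ} [∀ p : Face P k, Fintype (LinkV p)]
    [∀ p : Face P k, Fintype (LinkE p)] (z : l2Cocycles (P := P) r k) (s : Finset (Face P k)) :
    ∑ p ∈ s, incEnergy (linkInc p) (localize r (L2Cochain.val k (k + 1) z.1) p) ≤
      k * ‖z‖ ^ 2 := by
  set φ := L2Cochain.val k (k + 1) z.1 with hφ
  have hcoc : coboundary r (k + 1) φ = 0 := z.2
  let e : Face P k → Face P (k + 1 + 1) → ℝ := fun p c =>
    (∑ b ∈ facets c, ∑ b' ∈ facets c, if p.1 ⋖ b.1 ∧ p.1 ⋖ b'.1 then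
      (sgn r p.1 b.1 * φ b - sgn r p.1 b'.1 * φ b') ^ 2 else 0) / 2
  have he0 : ∀ p c, 0 ≤ e p c := fun p c => div_nonneg
    (Finset.sum_nonneg fun b _ => Finset.sum_nonneg fun b' _ => by split_ifs <;> positivity)
    zero_le_two
  have he : ∀ p c, ¬ p.1 < c.1 → e p c = 0 := by
    intro p c h
    have : ∀ b ∈ facets c, ¬ p.1 ⋖ b.1 := fun b hb hpb => h (hpb.lt.trans (mem_facets.1 hb).lt)
    show _ / 2 = (0 : ℝ)
    rw [Finset.sum_eq_zero, zero_div]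
    intro b hb
    exact Finset.sum_eq_zero fun b' _ => if_neg fun h => this b hb h.1
  let Cs : Finset (Face P (k + 1 + 1)) :=
    s.biUnion fun p => (Finset.univ : Finset (LinkE p)).image Subtype.val
  let U : Finset (Face P (k + 1)) := Cs.biUnion facets
  have hE : ∀ p ∈ s, incEnergy (linkInc p) (localize r φ p) = ∑ c ∈ Cs, e p c := by
    intro p hp
    rw [incEnergy_localize]
    have h1 : ∑ c : LinkE p, e p c.1 =
        ∑ c ∈ (Finset.univ : Finset (LinkE p)).image Subtype.val, e p c :=
      (Finset.sum_image fun _ _ _ _ h => Subtype.ext h).symm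
    refine h1.trans (Finset.sum_subset ?_ ?_)
    · exact Finset.subset_biUnion_of_mem
        (fun p => (Finset.univ : Finset (LinkE p)).image Subtype.val) hp
    · intro c _ hc
      refine he p c fun hpc => hc ?_
      exact Finset.mem_image.2 ⟨⟨c, hpc⟩, Finset.mem_univ _, rfl⟩
  -- Enlarging `s` by all facets of facets of `c` only adds non-negative terms and makes the pair
  -- identity applicable; its coboundary term vanishes on a cocycle.
  have hc : ∀ c, ∑ p ∈ s, e p c ≤ k * ∑ b ∈ facets c, φ b ^ 2 := by
    intro c
    have h1 := hP.sum_pairs r c φ (s ∪ (facets c).biUnion facets) fun b hb =>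
      (Finset.subset_biUnion_of_mem facets hb).trans Finset.subset_union_right
    rw [hcoc] at h1
    simp only [Pi.zero_apply, ne_eq, OfNat.ofNat_ne_zero, not_false_eq_true, zero_pow,
      zero_add] at h1
    rw [← h1]
    exact Finset.sum_le_sum_of_subset_of_nonneg Finset.subset_union_left fun p _ _ => he0 p c
  -- Only an inequality: `Cs` may miss some faces over `b`, and the weight is `1` even where there
  -- are none.
  have hb : ∀ b : Face P (k + 1), ((Cs.filter fun c => b ∈ facets c).card : ℝ) ≤ weight k b.1 := by
    intro b
    refine le_max_of_le_right ?_
    have hfin : {c : Face P (k + 1 + 1) | b.1 ≤ c.1}.Finite :=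
      (hL b.1 (b.ne_bot (by omega))).preimage (f := fun c : Face P (k + 1 + 1) => c.1)
        Subtype.val_injective.injOn
    rw [Nat.cast_le, ← Set.ncard_coe_finset]
    refine Set.ncard_le_ncard (fun c hc => ?_) hfin
    exact (mem_facets.1 (Finset.mem_filter.1 hc).2).le
  calc _ = ∑ p ∈ s, ∑ c ∈ Cs, e p c := Finset.sum_congr rfl hE
    _ = ∑ c ∈ Cs, ∑ p ∈ s, e p c := Finset.sum_comm
    _ ≤ ∑ c ∈ Cs, k * ∑ b ∈ facets c, φ b ^ 2 := Finset.sum_le_sum fun c _ => hc c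
    _ = k * ∑ c ∈ Cs, ∑ b ∈ U, if b ∈ facets c then φ b ^ 2 else 0 := by
        rw [← Finset.mul_sum]
        congr 1
        refine Finset.sum_congr rfl fun c hc => ?_
        rw [← Finset.sum_filter]
        refine Finset.sum_congr ?_ fun _ _ => rfl
        ext b
        rw [Finset.mem_filter]
        exact ⟨fun h => ⟨Finset.mem_biUnion.2 ⟨c, hc, h⟩, h⟩, fun h => h.2⟩
    _ = k * ∑ b ∈ U, ((Cs.filter fun c => b ∈ facets c).card : ℝ) * φ b ^ 2 := by
        rw [Finset.sum_comm]
        congr 1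
        refine Finset.sum_congr rfl fun b _ => ?_
        rw [← Finset.sum_filter, Finset.sum_const, nsmul_eq_mul]
    _ ≤ k * ∑ b ∈ U, weight k b.1 * φ b ^ 2 := by
        refine mul_le_mul_of_nonneg_left (Finset.sum_le_sum fun b _ => ?_) (Nat.cast_nonneg k)
        exact mul_le_mul_of_nonneg_right (hb b) (sq_nonneg _)
    _ ≤ k * ‖z‖ ^ 2 := by
        refine mul_le_mul_of_nonneg_left ?_ (Nat.cast_nonneg k)
        exact sum_le_hasSum U (fun b _ => mul_nonneg (weight_pos k b.1).le (sq_nonneg _))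
          (L2Cochain.hasSum_norm_sq z.1)

end Energy

/-! ### Density of the images of the connecting homomorphisms -/

section Density

variable {P : Type u} [PartialOrder P] [OrderBot P]

/-- The Poincaré inequality in the link of `p`. -/
theorem link_poincare (hP : IsSimplicial P) {k : ℕ} (p : Face P k) [Fintype (LinkV p)]
    [Fintype (LinkE p)] {β : ℝ}
    (hβ : ∀ a : GarlandPoset.Low P k, (β : EReal) < GarlandPoset.spectralGap a)
    {f : LinkV p → ℝ} (hf : f ≠ 0) (hperp : ∀ g, LocConst (linkInc p) g →
      ∑ v : LinkV p, weight k v.1.1 * (g v * f v) = 0) :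
    β * ∑ v : LinkV p, weight k v.1.1 * f v ^ 2 < incEnergy (linkInc p) f :=
  poincare_of_perp (w := fun v : LinkV p => weight k v.1.1) (fun v => weight_pos k v.1.1) (lt_of_incLaplacian_eq hP p hβ) hf hperp

theorem link_poincare_le (hP : IsSimplicial P) {k : ℕ} (p : Face P k) [Fintype (LinkV p)]
    [Fintype (LinkE p)] {β : ℝ}
    (hβ : ∀ a : GarlandPoset.Low P k, (β : EReal) < GarlandPoset.spectralGap a)
    {f : LinkV p → ℝ} (hperp : ∀ g, LocConst (linkInc p) g →
      ∑ v : LinkV p, weight k v.1.1 * (g v * f v) = 0) :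
    β * ∑ v : LinkV p, weight k v.1.1 * f v ^ 2 ≤ incEnergy (linkInc p) f := by
  by_cases hf : f = 0
  · subst hf
    simp [incEnergy]
  · exact (link_poincare hP p hβ hf hperp).le

/-- Duality of `λ_p` and localization at `p`: orthogonality to the image of `λ_p` becomes weighted
orthogonality to the locally constant functions on the link. -/
theorem inner_extendL2Cocycle (hP : IsSimplicial P) (hL : IsLocallyFinite P) (r : P → P → Prop)
    [IsStrictTotalOrder P r] {k : ℕ} (hk : 1 ≤ k) (p : Face P k) [Fintype (LinkV p)]
    (g : LinkV p → ℝ) (hg : LocConst (linkInc p) g) (z : l2Cocycles (P := P) r k) :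
    inner ℝ (extendL2Cocycle hP hL r hk p (locConstCocycle hP r p g hg)) z =
      ∑ v : LinkV p, weight k v.1.1 *
        (g v * localize r (L2Cochain.val k (k + 1) z.1) p v) := by
  rw [Submodule.coe_inner, L2Cochain.inner_eq_tsum]
  have hval : ∀ b, L2Cochain.val k (k + 1)
      (extendL2Cocycle hP hL r hk p (locConstCocycle hP r p g hg)).1 b =
      if h : p.1 ⋖ b.1 then sgn r p.1 b.1 * g ⟨b, h⟩ else 0 := fun b => rfl
  rw [tsum_eq_sum (s := (Finset.univ : Finset (LinkV p)).map (Function.Embedding.subtype _)),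
    Finset.sum_map]
  · refine Finset.sum_congr rfl fun v _ => ?_
    rw [hval]
    have : p.1 ⋖ (Function.Embedding.subtype (fun b : Face P (k + 1) => p.1 ⋖ b.1) v).1 := v.2
    rw [dif_pos this]
    simp only [Function.Embedding.coe_subtype, localize]
    ring
  · intro b hb
    rw [hval, dif_neg, zero_mul, mul_zero]
    intro h
    exact hb (Finset.mem_map.2 ⟨⟨b, h⟩, Finset.mem_univ _, rfl⟩)

theorem hasSum_localize (hP : IsSimplicial P) (r : P → P → Prop) {k : ℕ}
    [∀ p : Face P k, Fintype (LinkV p)] (φ : L2Cochain P k (k + 1)) :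
    HasSum (fun p : Face P k => ∑ v : LinkV p, weight k v.1.1 *
      localize r (L2Cochain.val k (k + 1) φ) p v ^ 2) ((k + 1) * ‖φ‖ ^ 2) := by
  have h := (hP.hasSum_pairs (fun b => mul_nonneg (weight_pos k b.1).le (sq_nonneg _))
    φ.hasSum_norm_sq).sigma fun p => hasSum_fintype _
  refine h.congr_fun fun p => Finset.sum_congr rfl fun v _ => ?_
  rw [localize, mul_pow, sgn_sq, one_mul]

/-- The cocycles coming from the links span a dense subspace of the square-summable cocycles. -/
theorem topologicalClosure_iSup_range_extendL2Cocycle (hP : IsSimplicial P)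
    (hL : IsLocallyFinite P) (r : P → P → Prop) [IsStrictTotalOrder P r] {k : ℕ} (hk : 1 ≤ k)
    (hgap : ∀ a : GarlandPoset.Low P k,
      (((k : ℝ) / ((k : ℝ) + 1) : ℝ) : EReal) < GarlandPoset.spectralGap a) :
    (⨆ p : Face P k, LinearMap.range (extendL2Cocycle hP hL r hk p)).topologicalClosure = ⊤ := by
  have := fun p : Face P k => finite_linkV hL hk p
  have := fun p : Face P k => finite_linkE hL hk p
  let := fun p : Face P k => Fintype.ofFinite (LinkV p)
  let := fun p : Face P k => Fintype.ofFinite (LinkE p)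
  rw [Submodule.topologicalClosure_eq_top_iff, Submodule.eq_bot_iff]
  intro z hz
  set φ := L2Cochain.val k (k + 1) z.1 with hφ
  have hperp : ∀ p, ∀ g, LocConst (linkInc p) g →
      ∑ v : LinkV p, weight k v.1.1 * (g v * localize r φ p v) = 0 := by
    intro p g hg
    rw [← inner_extendL2Cocycle hP hL r hk p g hg z]
    exact hz _ (Submodule.mem_iSup_of_mem p ⟨_, rfl⟩)
  by_contra hne
  obtain ⟨b, hb⟩ : ∃ b, φ b ≠ 0 := by
    by_contra! h
    apply hne
    apply Subtype.ext
    apply Subtype.ext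
    exact funext h
  obtain ⟨p₀, hp₀⟩ : (facets b).Nonempty := by
    rw [← Finset.card_pos, hP.card_facets]
    omega
  have hf₀ : localize r φ p₀ ≠ 0 := by
    intro h
    have h1 := congrFun h ⟨b, mem_facets.1 hp₀⟩
    have h2 := sgn_sq r p₀.1 b.1
    rcases mul_eq_zero.1 (show sgn r p₀.1 b.1 * φ b = 0 from h1) with h | h
    · rw [h] at h2; norm_num at h2
    · exact hb h
  set β : ℝ := (k : ℝ) / ((k : ℝ) + 1) with hβ
  let N : Face P k → ℝ := fun p => ∑ v : LinkV p, weight k v.1.1 * localize r φ p v ^ 2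
  let E : Face P k → ℝ := fun p => incEnergy (linkInc p) (localize r φ p)
  have hδ : 0 < E p₀ - β * N p₀ := sub_pos.2 (link_poincare hP p₀ hgap hf₀ (hperp p₀))
  -- Strict inequalities do not survive infinite sums, so the surplus at the single face `p₀` is
  -- carried along explicitly.
  have hsum : HasSum (fun p => β * N p + if p = p₀ then E p₀ - β * N p₀ else 0)
      (β * ((k + 1) * ‖z‖ ^ 2) + (E p₀ - β * N p₀)) :=
    ((hasSum_localize hP r z.1).mul_left β).add (hasSum_ite_eq p₀ _)
  have hle : β * ((k + 1) * ‖z‖ ^ 2) + (E p₀ - β * N p₀) ≤ k * ‖z‖ ^ 2 := by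
    refine hasSum_le_of_sum_le hsum fun s => ?_
    refine le_trans (Finset.sum_le_sum fun p _ => ?_) (sum_incEnergy_le hP hL r z s)
    show _ ≤ E p
    split_ifs with h
    · rw [h]; linarith
    · rw [add_zero]
      exact link_poincare_le hP p hgap (hperp p)
  have hk1 : (k : ℝ) + 1 ≠ 0 := by positivity
  -- At the critical value of `β` both totals coincide, so no positive surplus is possible.
  have : β * ((k + 1) * ‖z‖ ^ 2) = k * ‖z‖ ^ 2 := by
    rw [hβ]; field_simp
  linarith

end Density

/-- An operator between Hilbert spaces which is bounded below has a surjective adjoint. -/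
theorem exists_adjoint_apply_eq {E F : Type*} [NormedAddCommGroup E] [InnerProductSpace ℝ E]
    [CompleteSpace E] [NormedAddCommGroup F] [InnerProductSpace ℝ F] [CompleteSpace F]
    (R : E →L[ℝ] F) {c : ℝ} (hc : 0 < c) (hR : ∀ z, c * ‖z‖ ^ 2 ≤ ‖R z‖ ^ 2) (z : E) :
    ∃ w, ContinuousLinearMap.adjoint R (R w) = z := by
  lift c to NNReal using hc.le
  have h1 : ∀ z, inner ℝ ((ContinuousLinearMap.adjoint R ∘L R) z) z = ‖R z‖ ^ 2 := by
    intro z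
    rw [ContinuousLinearMap.comp_apply, ContinuousLinearMap.adjoint_inner_left,
      real_inner_self_eq_norm_sq]
  -- The lower bound on `R` makes the composite of `R` with its adjoint coercive, hence invertible.
  have hA : IsUnit (ContinuousLinearMap.adjoint R ∘L R) := by
    refine ContinuousLinearMap.isUnit_of_forall_le_norm_inner_map _ (NNReal.coe_pos.1 hc)
      fun z => ?_
    rw [h1, Real.norm_of_nonneg (sq_nonneg _), mul_comm]
    exact hR z
  obtain ⟨B, hB⟩ := hA.exists_right_inv
  exact ⟨B z, congrArg (fun T : E →L[ℝ] E => T z) hB⟩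

/-! ### Surjectivity of the sum of the connecting homomorphisms -/

section Surjectivity

variable {P : Type u} [PartialOrder P] [OrderBot P]

/-- The Hilbert space of square-summable functions on incident pairs of a `(k-1)`-face and a
`k`-face. -/
abbrev PairSpace (P : Type u) [PartialOrder P] (k : ℕ) : Type u :=
  lp (fun _ : (Σ p : Face P k, LinkV p) => ℝ) 2

theorem hasSum_localize_pairs (hP : IsSimplicial P) (r : P → P → Prop) {k : ℕ}
    (φ : L2Cochain P k (k + 1)) : HasSum (fun x : Σ p : Face P k, LinkV p =>
      (√(weight k x.2.1.1) * localize r (L2Cochain.val k (k + 1) φ) x.1 x.2) ^ 2)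
      ((k + 1) * ‖φ‖ ^ 2) := by
  refine (hP.hasSum_pairs (fun b => mul_nonneg (weight_pos k b.1).le (sq_nonneg _))
    φ.hasSum_norm_sq).congr_fun fun x => ?_
  rw [localize, mul_pow, mul_pow, sgn_sq, one_mul, Real.sq_sqrt (weight_pos k x.2.1.1).le]

/-- All localizations of a square-summable cochain, normalized by the square root of the weight,
as a linear map. -/
def localizeLinear (hP : IsSimplicial P) (r : P → P → Prop) (k : ℕ) :
    L2Cochain P k (k + 1) →ₗ[ℝ] PairSpace P k where
  toFun φ := ⟨fun x => √(weight k x.2.1.1) * localize r (L2Cochain.val k (k + 1) φ) x.1 x.2, by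
    apply memℓp_gen
    refine (hasSum_localize_pairs hP r φ).summable.congr fun x => ?_
    simp [mul_pow]⟩
  map_add' φ ψ := by
    ext x
    simp only [map_add, localize, Pi.add_apply, mul_add]
    rfl
  map_smul' t φ := by
    ext x
    simp [localize, mul_left_comm]

theorem norm_localizeLinear_sq (hP : IsSimplicial P) (r : P → P → Prop) (k : ℕ)
    (φ : L2Cochain P k (k + 1)) : ‖localizeLinear hP r k φ‖ ^ 2 = (k + 1) * ‖φ‖ ^ 2 :=
  (lp_hasSum_sq (localizeLinear hP r k φ)).unique (hasSum_localize_pairs hP r φ)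

/-- All localizations of a square-summable cochain, normalized by the square root of the weight,
as a bounded operator. -/
def localizeL2 (hP : IsSimplicial P) (r : P → P → Prop) (k : ℕ) :
    L2Cochain P k (k + 1) →L[ℝ] PairSpace P k :=
  (localizeLinear hP r k).mkContinuous (√(k + 1)) fun φ => by
    rw [← sq_le_sq₀ (norm_nonneg _) (mul_nonneg (Real.sqrt_nonneg _) (norm_nonneg _)), mul_pow,
      Real.sq_sqrt (by positivity), norm_localizeLinear_sq]

theorem localizeL2_apply (hP : IsSimplicial P) (r : P → P → Prop) (k : ℕ)
    (φ : L2Cochain P k (k + 1)) (x : Σ p : Face P k, LinkV p) : localizeL2 hP r k φ x =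
      √(weight k x.2.1.1) * localize r (L2Cochain.val k (k + 1) φ) x.1 x.2 := rfl

theorem norm_localizeL2_sq (hP : IsSimplicial P) (r : P → P → Prop) (k : ℕ)
    (φ : L2Cochain P k (k + 1)) : ‖localizeL2 hP r k φ‖ ^ 2 = (k + 1) * ‖φ‖ ^ 2 :=
  norm_localizeLinear_sq hP r k φ

/-- The function on the link of `p` which an element of `PairSpace` defines. -/
def linkPart {k : ℕ} (g : PairSpace P k) (p : Face P k) (v : LinkV p) : ℝ :=
  g ⟨p, v⟩ / √(weight k v.1.1)

theorem sqrt_weight_mul_linkPart {k : ℕ} (g : PairSpace P k) (p : Face P k) (v : LinkV p) :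
    √(weight k v.1.1) * linkPart g p v = g ⟨p, v⟩ :=
  mul_div_cancel₀ _ (Real.sqrt_pos.2 (weight_pos k v.1.1)).ne'

theorem weight_mul_linkPart_sq {k : ℕ} (g : PairSpace P k) (p : Face P k) (v : LinkV p) :
    weight k v.1.1 * linkPart g p v ^ 2 = g ⟨p, v⟩ ^ 2 := by
  rw [← sqrt_weight_mul_linkPart g p v, mul_pow, Real.sq_sqrt (weight_pos k v.1.1).le]

variable (P) in
/-- The Hilbert sum of the spaces of locally constant functions on the links. -/
def locConstFamilies (k : ℕ) : Submodule ℝ (PairSpace P k) where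
  carrier := {g | ∀ p, LocConst (linkInc p) (linkPart g p)}
  add_mem' := by
    intro g h hg hh p v v' c hv hv'
    have h1 := hg p v v' c hv hv'
    have h2 := hh p v v' c hv hv'
    simp only [linkPart] at h1 h2
    simp only [linkPart, lp.coeFn_add, Pi.add_apply, add_div, h1, h2]
  zero_mem' := by
    intro p v v' c hv hv'
    simp [linkPart]
  smul_mem' := by
    intro t g hg p v v' c hv hv'
    have h1 := hg p v v' c hv hv'
    simp only [linkPart] at h1
    simp only [linkPart, lp.coeFn_smul, Pi.smul_apply, smul_eq_mul, mul_div_assoc, h1]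

theorem isClosed_locConstFamilies (k : ℕ) :
    IsClosed (locConstFamilies P k : Set (PairSpace P k)) := by
  have : (locConstFamilies P k : Set (PairSpace P k)) = ⋂ (p : Face P k) (v : LinkV p)
      (v' : LinkV p) (c : LinkE p) (_ : linkInc p v c) (_ : linkInc p v' c),
      {g | linkPart g p v = linkPart g p v'} := by
    ext g
    simp only [Set.mem_iInter]
    rfl
  rw [this]
  have hc : ∀ (p : Face P k) (v : LinkV p), Continuous fun g : PairSpace P k => linkPart g p v :=
    fun p v => (lp.evalCLM ℝ (fun _ : (Σ p : Face P k, LinkV p) => ℝ) 2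
      ⟨p, v⟩).continuous.div_const _
  exact isClosed_iInter fun p => isClosed_iInter fun v => isClosed_iInter fun v' =>
    isClosed_iInter fun c => isClosed_iInter fun _ => isClosed_iInter fun _ =>
      isClosed_eq (hc p v) (hc p v')

instance (k : ℕ) : CompleteSpace (locConstFamilies P k) :=
  (isClosed_locConstFamilies k).completeSpace_coe

/-- An element orthogonal to the locally constant families is, in every link, orthogonal to the
locally constant functions. -/
theorem sum_eq_zero_of_mem_orthogonal {k : ℕ} {y : PairSpace P k}
    (hy : y ∈ (locConstFamilies P k)ᗮ) (p : Face P k) [Fintype (LinkV p)] (u : LinkV p → ℝ)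
    (hu : LocConst (linkInc p) u) :
    ∑ v : LinkV p, weight k v.1.1 * (u v * linkPart y p v) = 0 := by
  -- The test family equal to `u`, suitably normalized, on the link of `p` and to `0` on all other
  -- links.
  let g : PairSpace P k := ∑ v : LinkV p, lp.single 2 ⟨p, v⟩ (√(weight k v.1.1) * u v)
  have hgapp : ∀ x, g x = ∑ v : LinkV p,
      (Pi.single (⟨p, v⟩ : Σ p : Face P k, LinkV p) (√(weight k v.1.1) * u v) : _ → ℝ) x := by
    intro x
    simp only [g, lp.coeFn_sum, Finset.sum_apply]
    rfl
  have hgp : ∀ v : LinkV p, g ⟨p, v⟩ = √(weight k v.1.1) * u v := by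
    intro v
    rw [hgapp, Finset.sum_eq_single v]
    · simp
    · intro v' _ hv'
      rw [Pi.single_eq_of_ne]
      intro h
      exact hv' (by simpa using h.symm)
    · simp
  have hgq : ∀ (q : Face P k) (v : LinkV q), q ≠ p → g ⟨q, v⟩ = 0 := by
    intro q v hq
    rw [hgapp]
    refine Finset.sum_eq_zero fun v' _ => ?_
    rw [Pi.single_eq_of_ne]
    intro h
    exact hq (congrArg Sigma.fst h)
  have hg : g ∈ locConstFamilies P k := by
    intro q v v' c hv hv'
    by_cases hq : q = p
    · subst hq
      have h0 : ∀ v : LinkV q, linkPart g q v = u v := by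
        intro v
        rw [linkPart, hgp]
        exact mul_div_cancel_left₀ _ (Real.sqrt_pos.2 (weight_pos k v.1.1)).ne'
      rw [h0, h0]
      exact hu v v' c hv hv'
    · simp only [linkPart, hgq q _ hq]
      simp
  have h1 : inner ℝ g y = 0 := hy g hg
  simp only [g, sum_inner, lp.inner_single_left] at h1
  rw [← h1]
  refine Finset.sum_congr rfl fun v _ => ?_
  rw [← sqrt_weight_mul_linkPart y p v]
  have := Real.mul_self_sqrt (weight_pos k v.1.1).le
  simp only [RCLike.inner_apply, conj_trivial]
  linear_combination (-(u v * linkPart y p v)) * this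

/-- On the facets of a given `c` the family can be summed over one common finite set `T`, so the
value at `c` is a finite sum of values of coboundaries of cocycles. -/
theorem sumExtend_mem_cocycles (hP : IsSimplicial P) (r : P → P → Prop) [IsStrictTotalOrder P r]
    {k : ℕ} (f : ∀ p : Face P k, cocycles (linkOrder r p.1) 0) :
    sumExtend r f ∈ cocycles r k := by
  rw [cocycles, LinearMap.mem_ker]
  funext c
  let T : Finset (Face P k) := (facets c).biUnion facets
  have h1 : ∀ b ∈ facets c, sumExtend r f b = ∑ p ∈ T, extendLink r p (f p).1 b := by
    intro b hb
    refine Finset.sum_subset (Finset.subset_biUnion_of_mem facets hb) fun p _ hp => ?_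
    have : ¬ p.1 ⋖ b.1 := fun h => hp (mem_facets.2 h)
    simp [extendLink, this]
  show ∑ b ∈ facets c, sgn r b.1 c.1 * sumExtend r f b = 0
  rw [Finset.sum_congr rfl fun b hb => by rw [h1 b hb, Finset.mul_sum], Finset.sum_comm]
  refine Finset.sum_eq_zero fun p _ => ?_
  exact congrFun (extendLink_mem_cocycles hP r p (f p).2) c

/-- A locally constant family as a family of cocycles in the links. -/
def familyCocycles (hP : IsSimplicial P) (r : P → P → Prop) [IsStrictTotalOrder P r] {k : ℕ}
    (g : locConstFamilies P k) (p : Face P k) : cocycles (linkOrder r p.1) 0 :=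
  locConstCocycle hP r p (linkPart g.1 p) (g.2 p)

theorem familyCocycles_mem_linkFamilies (hP : IsSimplicial P) (r : P → P → Prop)
    [IsStrictTotalOrder P r] {k : ℕ} (g : locConstFamilies P k) :
    familyCocycles hP r g ∈ linkFamilies r k :=
  (lp_hasSum_sq g.1).summable.congr fun x => (weight_mul_linkPart_sq g.1 x.1 x.2).symm

/-- Both sides are tested against the indicator of a face `b`: its localization lives on the pairs
`(p, b)` with `p` a facet of `b`, and the factor `weight k b` cancels. -/
theorem adjoint_localizeL2_apply (hP : IsSimplicial P) (r : P → P → Prop) [IsStrictTotalOrder P r]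
    {k : ℕ} (g : locConstFamilies P k) :
    L2Cochain.val k (k + 1) (ContinuousLinearMap.adjoint (localizeL2 hP r k) g.1) =
      sumExtend r (familyCocycles hP r g) := by
  funext b
  let e : L2Cochain P k (k + 1) := ⟨Pi.single b 1, single_mem_sqSummable b 1⟩
  have he : ∀ b', L2Cochain.val k (k + 1) e b' = (Pi.single b 1 : Cochain P (k + 1)) b' :=
    fun _ => rfl
  have hw := (weight_pos k b.1).ne'
  have h1 : inner ℝ (ContinuousLinearMap.adjoint (localizeL2 hP r k) g.1) e =
      weight k b.1 *
        L2Cochain.val k (k + 1) (ContinuousLinearMap.adjoint (localizeL2 hP r k) g.1) b := by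
    rw [L2Cochain.inner_eq_tsum, tsum_eq_single b]
    · rw [he]; simp
    · intro b' hb'
      rw [he, Pi.single_eq_of_ne hb']
      simp
  have h2 : inner ℝ g.1 (localizeL2 hP r k e) =
      weight k b.1 * sumExtend r (familyCocycles hP r g) b := by
    let ι : {p // p ∈ facets b} ↪ Σ p : Face P k, LinkV p :=
      ⟨fun p => ⟨p.1, b, mem_facets.1 p.2⟩, fun p p' h => Subtype.ext (congrArg Sigma.fst h)⟩
    rw [lp.inner_eq_tsum, tsum_eq_sum (s := (facets b).attach.map ι), Finset.sum_map, sumExtend,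
      Finset.mul_sum, ← Finset.sum_attach (facets b)]
    · refine Finset.sum_congr rfl fun p _ => ?_
      have hpb := mem_facets.1 p.2
      have h3 : extendLink r p.1 (familyCocycles hP r g p.1).1 b =
        sgn r p.1.1 b.1 * linkPart g.1 p.1 ⟨b, hpb⟩ := dif_pos hpb
      have h4 : localizeL2 hP r k e (ι p) = √(weight k b.1) * (sgn r p.1.1 b.1 * 1) := by
        rw [localizeL2_apply, localize, he]
        congr 2
        exact Pi.single_eq_same (M := fun _ => ℝ) b 1
      have h5 : g.1 (ι p) = √(weight k b.1) * linkPart g.1 p.1 ⟨b, hpb⟩ :=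
        (sqrt_weight_mul_linkPart g.1 p.1 ⟨b, hpb⟩).symm
      rw [h3, h4, h5]
      have := Real.mul_self_sqrt (weight_pos k b.1).le
      simp only [RCLike.inner_apply, conj_trivial]
      linear_combination (sgn r p.1.1 b.1 * linkPart g.1 p.1 ⟨b, hpb⟩) * this
    · intro x hx
      have h3 : localizeL2 hP r k e x = 0 := by
        rw [localizeL2_apply, localize, he, Pi.single_eq_of_ne]
        · simp
        · rintro rfl
          exact hx (Finset.mem_map.2 ⟨⟨x.1, mem_facets.2 x.2.2⟩, Finset.mem_attach _ _, rfl⟩)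
      rw [h3]
      simp
  rw [ContinuousLinearMap.adjoint_inner_left, h2] at h1
  exact (mul_left_cancel₀ hw h1).symm

/-- The localization of square-summable cocycles, projected to the locally constant families. -/
def projectedLocalization (hP : IsSimplicial P) (r : P → P → Prop) (k : ℕ) :
    l2Cocycles (P := P) r k →L[ℝ] locConstFamilies P k :=
  (locConstFamilies P k).orthogonalProjectionOnto ∘L localizeL2 hP r k ∘L
    (l2Cocycles (P := P) r k).subtypeL

/-- The adjoint of the orthogonal projection is the inclusion. The adjoint of localization already
sends locally constant families to cocycles, so restricting to cocycles requires no further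
projection. -/
theorem adjoint_projectedLocalization_apply (hP : IsSimplicial P) (r : P → P → Prop)
    [IsStrictTotalOrder P r] {k : ℕ} (g : locConstFamilies P k) :
    L2Cochain.val k (k + 1) (ContinuousLinearMap.adjoint (projectedLocalization hP r k) g).1 =
      sumExtend r (familyCocycles hP r g) := by
  have hmem : ContinuousLinearMap.adjoint (localizeL2 hP r k) g.1 ∈ l2Cocycles (P := P) r k := by
    show L2Cochain.val k (k + 1) _ ∈ cocycles r k
    rw [adjoint_localizeL2_apply]
    exact sumExtend_mem_cocycles hP r _
  have h : ContinuousLinearMap.adjoint (projectedLocalization hP r k) g = ⟨_, hmem⟩ := by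
    refine ext_inner_right ℝ fun z => ?_
    rw [ContinuousLinearMap.adjoint_inner_left, Submodule.coe_inner (l2Cocycles r k),
      ContinuousLinearMap.adjoint_inner_left]
    exact Submodule.inner_orthogonalProjectionOnto_eq_of_mem_left g _
  rw [h, adjoint_localizeL2_apply]

/-- The quantitative form of Garland's estimate. The localization `x` splits orthogonally as `g + y`
with `‖x‖² = (k + 1) ‖z‖²`, and the Poincaré inequality bounds `γ ‖y‖²` by the total energy, hence
by `k ‖z‖²`. -/
theorem projectedLocalization_lower_bound (hP : IsSimplicial P) (hL : IsLocallyFinite P)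
    (r : P → P → Prop) [IsStrictTotalOrder P r] {k : ℕ} (hk : 1 ≤ k) {γ : ℝ} (hγ : 0 < γ)
    (hgap : ∀ a : GarlandPoset.Low P k, (γ : EReal) < GarlandPoset.spectralGap a)
    (z : l2Cocycles (P := P) r k) :
    (k + 1 - k / γ) * ‖z‖ ^ 2 ≤ ‖projectedLocalization hP r k z‖ ^ 2 := by
  have := fun p : Face P k => finite_linkV hL hk p
  have := fun p : Face P k => finite_linkE hL hk p
  let := fun p : Face P k => Fintype.ofFinite (LinkV p)
  let := fun p : Face P k => Fintype.ofFinite (LinkE p)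
  set x : PairSpace P k := localizeL2 hP r k z.1 with hx
  set g := projectedLocalization hP r k z with hg
  have hgx : g = (locConstFamilies P k).orthogonalProjectionOnto x := rfl
  set y : PairSpace P k := x - g.1 with hydef
  have hy : y ∈ (locConstFamilies P k)ᗮ := by
    rw [hydef, hgx]
    exact Submodule.sub_starProjection_mem_orthogonal x
  have hpyth : ‖x‖ ^ 2 = ‖g‖ ^ 2 + ‖y‖ ^ 2 := by
    have h1 : inner ℝ g.1 y = 0 := hy g.1 g.2
    have h2 : x = g.1 + y := by rw [hydef]; abel
    rw [h2, sq, sq, sq, norm_add_sq_eq_norm_sq_add_norm_sq_of_inner_eq_zero _ _ h1]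
    rfl
  have hx2 : ‖x‖ ^ 2 = (k + 1) * ‖z‖ ^ 2 := norm_localizeL2_sq hP r k z.1
  have hpart : ∀ p, linkPart y p =
      localize r (L2Cochain.val k (k + 1) z.1) p - linkPart g.1 p := by
    intro p
    funext v
    have h1 : y ⟨p, v⟩ = x ⟨p, v⟩ - g.1 ⟨p, v⟩ := rfl
    have h2 := (Real.sqrt_pos.2 (weight_pos k v.1.1)).ne'
    rw [Pi.sub_apply, linkPart, linkPart, h1, sub_div, hx, localizeL2_apply]
    rw [mul_div_cancel_left₀ _ h2]
  have hsum : HasSum (fun p => γ * ∑ v : LinkV p, weight k v.1.1 * linkPart y p v ^ 2)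
      (γ * ‖y‖ ^ 2) := by
    refine HasSum.mul_left γ ?_
    refine ((lp_hasSum_sq y).sigma fun p => hasSum_fintype _).congr_fun fun p => ?_
    exact Finset.sum_congr rfl fun v _ => weight_mul_linkPart_sq y p v
  have hle : γ * ‖y‖ ^ 2 ≤ k * ‖z‖ ^ 2 := by
    refine hasSum_le_of_sum_le hsum fun s => ?_
    refine le_trans (Finset.sum_le_sum fun p _ => ?_) (sum_incEnergy_le hP hL r z s)
    -- On each link `y` differs from the localization by a locally constant function, which does not
    -- change the energy.
    rw [← LocConst.incEnergy_sub (g.2 p), ← hpart]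
    exact link_poincare_le hP p hgap (sum_eq_zero_of_mem_orthogonal hy p)
  have hle' : ‖y‖ ^ 2 ≤ k / γ * ‖z‖ ^ 2 := by
    rw [div_mul_eq_mul_div, le_div_iff₀ hγ, mul_comm]
    exact hle
  linarith

/-- If the spectral gaps are uniformly larger than `k / (k + 1)`, then every square-summable
cocycle is a square-summable sum of cocycles coming from the links. -/
theorem exists_eq_sumExtend (hP : IsSimplicial P) (hL : IsLocallyFinite P)
    (r : P → P → Prop) [IsStrictTotalOrder P r] {k : ℕ} (hk : 1 ≤ k)
    (hgap : (((k : ℝ) / ((k : ℝ) + 1) : ℝ) : EReal) <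
      (⨅ a : GarlandPoset.Low P k, GarlandPoset.spectralGap a)) (z : l2Cocycles (P := P) r k) :
    ∃ f ∈ linkFamilies (P := P) r k, L2Cochain.val k (k + 1) z.1 = sumExtend r f := by
  obtain ⟨γ, hγ, hγ'⟩ := EReal.lt_iff_exists_real_btwn.1 hgap
  have hγ1 : (k : ℝ) / (k + 1) < γ := by exact_mod_cast hγ
  have hk0 : (0 : ℝ) < k := by exact_mod_cast hk
  have hγ0 : 0 < γ := lt_trans (by positivity) hγ1
  -- Positivity of this constant is exactly the condition `γ > k / (k + 1)`.
  have hc : 0 < (k : ℝ) + 1 - k / γ := by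
    rw [div_lt_iff₀ (by positivity)] at hγ1
    rw [sub_pos, div_lt_iff₀ hγ0]
    linarith
  obtain ⟨w, hw⟩ := exists_adjoint_apply_eq (projectedLocalization hP r k) hc
    (projectedLocalization_lower_bound hP hL r hk hγ0 fun a => hγ'.trans_le (iInf_le _ a)) z
  refine ⟨familyCocycles hP r (projectedLocalization hP r k w),
    familyCocycles_mem_linkFamilies hP r _, ?_⟩
  rw [← adjoint_projectedLocalization_apply, hw]

end Surjectivity

/-! ### Connected links -/

section Connected

variable {P : Type u} [PartialOrder P] [OrderBot P]

theorem extendLink_eq_coboundary_single (r : P → P → Prop) {k : ℕ} (p : Face P k)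
    {F : Cochain (Set.Ici p.1) (0 + 1)} {t : ℝ}
    (hF : ∀ b : LinkV p, F (linkVertex b.1 b.2) = t) :
    extendLink r p F = coboundary r k (Pi.single p t) := by
  funext b
  have hR : coboundary r k (Pi.single p t) b = if p.1 ⋖ b.1 then sgn r p.1 b.1 * t else 0 := by
    show ∑ y ∈ facets b, sgn r y.1 b.1 * (Pi.single p t : Face P k → ℝ) y = _
    simp only [Pi.single_apply, mul_ite, mul_zero]
    rw [Finset.sum_ite_eq' (facets b) p]
    simp only [mem_facets]
  rw [hR]
  by_cases h : p.1 ⋖ b.1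
  · rw [if_pos h, ← hF ⟨b, h⟩]
    exact dif_pos h
  · rw [if_neg h]
    exact dif_neg h

theorem sumExtend_eq_coboundary (r : P → P → Prop) {k : ℕ}
    (f : ∀ p : Face P k, cocycles (linkOrder r p.1) 0) (t : Cochain P k)
    (hf : ∀ (p : Face P k) (b : LinkV p), (f p).1 (linkVertex b.1 b.2) = t p) :
    sumExtend r f = coboundary r k t := by
  funext b
  refine Finset.sum_congr rfl fun p hp => ?_
  have h := mem_facets.1 hp
  rw [← hf p ⟨b, h⟩]
  exact dif_pos h

/-- Every `(k+1)`-face over `p` contains a `k`-face over `p`. Non-emptiness of the link covers the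
case where the weight of `p` is the default `1`. -/
theorem weight_le_sum_weight (hP : IsSimplicial P) (hL : IsLocallyFinite P) (r : P → P → Prop)
    [IsStrictTotalOrder P r] {k : ℕ} (p : Face P k) [Fintype (LinkV p)] [Nonempty (LinkV p)] :
    weight k p.1 ≤ ∑ v : LinkV p, weight k v.1.1 := by
  refine max_le ?_ ?_
  · obtain ⟨v⟩ := ‹Nonempty (LinkV p)›
    exact (le_max_left _ _).trans (Finset.single_le_sum
      (f := fun v : LinkV p => weight k v.1.1) (fun v _ => (weight_pos k v.1.1).le)
      (Finset.mem_univ v))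
  · have hfin : ∀ v : LinkV p, {c : Face P (k + 1 + 1) | v.1.1 ≤ c.1}.Finite := fun v =>
      (hL v.1.1 (v.1.ne_bot (by omega))).preimage (f := fun c : Face P (k + 1 + 1) => c.1)
        Subtype.val_injective.injOn
    have hsub : {c : Face P (k + 1 + 1) | p.1 ≤ c.1} ⊆
        ⋃ v : LinkV p, {c : Face P (k + 1 + 1) | v.1.1 ≤ c.1} := by
      intro c hc
      have hlt : p.1 < c.1 := lt_of_le_not_ge hc (Face.not_le_of_lt hP (by omega) p c)
      obtain ⟨b, -, hb, -⟩ := hP.link_edge r p ⟨c, hlt⟩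
      exact Set.mem_iUnion.2 ⟨b, hb.le⟩
    have h1 : {c : Face P (k + 1 + 1) | p.1 ≤ c.1}.ncard ≤
        ∑ v : LinkV p, {c : Face P (k + 1 + 1) | v.1.1 ≤ c.1}.ncard :=
      (Set.ncard_le_ncard hsub (Set.finite_iUnion hfin)).trans (Set.ncard_iUnion_le_of_fintype _)
    have h2 : ({c : Face P (k + 1 + 1) | p.1 ≤ c.1}.ncard : ℝ) ≤
        ∑ v : LinkV p, ({c : Face P (k + 1 + 1) | v.1.1 ≤ c.1}.ncard : ℝ) := by
      exact_mod_cast h1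
    exact h2.trans (Finset.sum_le_sum fun v _ => le_max_right _ _)

/-- The constants `t p` of the link functions form a primitive. It is square-summable because the
total weight of the vertices in a non-empty link dominates the weight of `p`. -/
theorem sumExtend_mem_map_coboundary (hP : IsSimplicial P) (hL : IsLocallyFinite P)
    (r : P → P → Prop) [IsStrictTotalOrder P r] {k : ℕ} (hk : 1 ≤ k)
    (hconn : ∀ p : Face P k, (linkGraph p).Preconnected)
    {f : ∀ p : Face P k, cocycles (linkOrder r p.1) 0} (hf : f ∈ linkFamilies r k) :
    sumExtend r f ∈ (sqSummable P k k).map (coboundary r k) := by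
  have := fun p : Face P k => finite_linkV hL hk p
  let := fun p : Face P k => Fintype.ofFinite (LinkV p)
  choose t ht ht0 using fun p => exists_eq_const_of_preconnected hP r p (hconn p) (f p).2
  refine ⟨t, ?_, (sumExtend_eq_coboundary r f t ht).symm⟩
  have h1 := (hf.hasSum.sigma fun p => hasSum_fintype _).summable
  refine Summable.of_nonneg_of_le (fun p => mul_nonneg (weight_pos k p.1).le (sq_nonneg _))
    (fun p => ?_) h1
  have h2 : ∑ v : LinkV p, weight k v.1.1 * (f p).1 (linkVertex v.1 v.2) ^ 2 =
      (∑ v : LinkV p, weight k v.1.1) * t p ^ 2 := by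
    rw [Finset.sum_mul]
    exact Finset.sum_congr rfl fun v _ => by rw [ht]
  refine le_trans ?_ h2.ge
  rcases isEmpty_or_nonempty (LinkV p) with he | he
  -- An empty link puts no constraint on the constant, so it has to be chosen as `0` for the
  -- primitive to remain square-summable.
  · rw [ht0 p he]; simp
  · exact mul_le_mul_of_nonneg_right (weight_le_sum_weight hP hL r p) (sq_nonneg _)

theorem iSup_range_extendL2Cocycle_le (hP : IsSimplicial P) (hL : IsLocallyFinite P)
    (r : P → P → Prop) [IsStrictTotalOrder P r] {k : ℕ} (hk : 1 ≤ k)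
    (hconn : ∀ p : Face P k, (linkGraph p).Preconnected) :
    (⨆ p : Face P k, LinearMap.range (extendL2Cocycle hP hL r hk p)) ≤ l2Coboundaries r k := by
  refine iSup_le fun p => ?_
  rintro _ ⟨F, rfl⟩
  obtain ⟨t, ht, -⟩ := exists_eq_const_of_preconnected hP r p (hconn p) F.2
  exact ⟨Pi.single p t, single_mem_sqSummable p t, (extendLink_eq_coboundary_single r p ht).symm⟩

/-! ### From cocycles to cohomology classes, and the case of a finite poset. -/

theorem range_mapQ {R M N : Type*} [Ring R] [AddCommGroup M] [AddCommGroup N] [Module R M]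
    [Module R N] (p : Submodule R M) (q : Submodule R N) (f : M →ₗ[R] N) (h : p ≤ q.comap f) :
    LinearMap.range (p.mapQ q f h) = (LinearMap.range f).map q.mkQ := by
  rw [← LinearMap.range_comp, ← Submodule.mapQ_mkQ p q f (h := h), LinearMap.range_comp,
    Submodule.range_mkQ, LinearMap.range_eq_map]

/-- The quotient map is continuous and surjective, hence carries the dense span of link cocycles to
a dense subspace. -/
theorem closedLinkSpan_eq_top (hP : IsSimplicial P) (hL : IsLocallyFinite P) (r : P → P → Prop)
    [IsStrictTotalOrder P r] {k : ℕ} (hk : 1 ≤ k)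
    (hgap : ∀ a : GarlandPoset.Low P k,
      (((k : ℝ) / ((k : ℝ) + 1) : ℝ) : EReal) < GarlandPoset.spectralGap a) :
    closedLinkSpan hP hL r hk = ⊤ := by
  have h := topologicalClosure_iSup_range_extendL2Cocycle hP hL r hk hgap
  rw [← Submodule.dense_iff_topologicalClosure_eq_top] at h
  unfold closedLinkSpan
  rw [← Submodule.dense_iff_topologicalClosure_eq_top]
  have hr : (⨆ p : Face P k, LinearMap.range (connectingL2 hP hL r hk p)) =
      (⨆ p : Face P k, LinearMap.range (extendL2Cocycle hP hL r hk p)).map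
        (l2Coboundaries (P := P) r k).topologicalClosure.mkQ := by
    rw [Submodule.map_iSup]
    exact iSup_congr fun p => range_mapQ _ _ _ _
  rw [hr, Submodule.map_coe]
  exact (Submodule.mkQ_surjective _).denseRange.dense_image (Submodule.continuous_mkQ _) h

/-- Over a finite poset every cochain is square-summable and the spaces are finite-dimensional, so
subspaces are closed and density means equality. -/
theorem iSup_range_extendCocycle_eq_top (hP : IsSimplicial P) (hL : IsLocallyFinite P)
    (r : P → P → Prop) [IsStrictTotalOrder P r] {k : ℕ} (hk : 1 ≤ k)
    (hgap : ∀ a : GarlandPoset.Low P k,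
      (((k : ℝ) / ((k : ℝ) + 1) : ℝ) : EReal) < GarlandPoset.spectralGap a) [Finite P] :
    (⨆ p : Face P k, LinearMap.range (extendCocycle hP r p)) = ⊤ := by
  have h := topologicalClosure_iSup_range_extendL2Cocycle hP hL r hk hgap
  have hface : Finite (Face P (k + 1)) := Subtype.finite
  have hfd : FiniteDimensional ℝ (L2Cochain P k (k + 1)) :=
    FiniteDimensional.of_injective (L2Cochain.val k (k + 1)) Subtype.val_injective
  rw [(Submodule.closed_of_finiteDimensional _).submodule_topologicalClosure_eq] at h
  let ι : l2Cocycles (P := P) r k →ₗ[ℝ] cocycles (P := P) r k :=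
    LinearMap.codRestrict (cocycles r k) (L2Cochain.val k (k + 1) ∘ₗ (l2Cocycles r k).subtype)
      fun z => z.2
  have hι : Function.Surjective ι := fun z =>
    ⟨⟨⟨z.1, Summable.of_finite⟩, z.2⟩, rfl⟩
  have h2 := congrArg (Submodule.map ι) h
  rw [Submodule.map_top, LinearMap.range_eq_top.2 hι, Submodule.map_iSup] at h2
  rw [← h2]
  refine iSup_congr fun p => ?_
  rw [← LinearMap.range_comp]
  rfl

end Connected

end SimplicialPoset

end

open SimplicialPoset in
theorem mainTheorem3 {P : Type*} [PartialOrder P] [OrderBot P]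
    (hP : IsSimplicial P) (hL : IsLocallyFinite P)
    (r : P → P → Prop) [IsStrictTotalOrder P r] (k : ℕ) (hk : 1 ≤ k)
    (hgap : ∀ a : GarlandPoset.Low P k,
      (((k : ℝ) / ((k : ℝ) + 1) : ℝ) : EReal) < GarlandPoset.spectralGap a) :
    (closedLinkSpan hP hL r hk = ⊤ ∧
      ((∀ p : Face P k, (linkGraph p).Preconnected) →
        Subsingleton (HausdorffL2Cohomology (P := P) r k))) ∧
    ((((k : ℝ) / ((k : ℝ) + 1) : ℝ) : EReal) <
        (⨅ a : GarlandPoset.Low P k, GarlandPoset.spectralGap a) →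
      hilbertLinkSum (P := P) r k = Set.univ ∧
      ((∀ p : Face P k, (linkGraph p).Preconnected) →
        Subsingleton (L2Cohomology (P := P) r k))) ∧
    (Finite P →
      linkSpan hP r k = ⊤ ∧
      ((∀ p : Face P k, (linkGraph p).Preconnected) →
        Subsingleton (Cohomology (P := P) r k))) := by
  refine ⟨⟨closedLinkSpan_eq_top hP hL r hk hgap, fun hconn => ?_⟩, fun hinf => ⟨?_, fun hconn => ?_⟩,
    fun hfin => ⟨?_, fun hconn => ?_⟩⟩
  -- For connected links the dense span of link cocycles consists of coboundaries, so the closure of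
  -- the coboundaries is everything.
  · rw [Submodule.Quotient.subsingleton_iff, eq_top_iff,
      ← topologicalClosure_iSup_range_extendL2Cocycle hP hL r hk hgap]
    exact Submodule.topologicalClosure_mono (iSup_range_extendL2Cocycle_le hP hL r hk hconn)
  · rw [Set.eq_univ_iff_forall]
    intro h
    obtain ⟨z, rfl⟩ := Submodule.mkQ_surjective _ h
    obtain ⟨f, hf, hz⟩ := exists_eq_sumExtend hP hL r hk hinf z
    exact ⟨f, hf, z, hz, rfl⟩
  · rw [Submodule.Quotient.subsingleton_iff, eq_top_iff]
    intro z _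
    obtain ⟨f, hf, hz⟩ := exists_eq_sumExtend hP hL r hk hinf z
    show L2Cochain.val k (k + 1) z.1 ∈ (sqSummable P k k).map (coboundary r k)
    rw [hz]
    exact sumExtend_mem_map_coboundary hP hL r hk hconn hf
  · have h : linkSpan hP r k = (⨆ p : Face P k, LinearMap.range (extendCocycle hP r p)).map
        ((coboundaries r k).comap (cocycles r k).subtype).mkQ := by
      rw [Submodule.map_iSup]
      exact iSup_congr fun p => range_mapQ _ _ _ _
    rw [h, iSup_range_extendCocycle_eq_top hP hL r hk hgap, Submodule.map_top,
      Submodule.range_mkQ]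
  · rw [Submodule.Quotient.subsingleton_iff, eq_top_iff,
      ← iSup_range_extendCocycle_eq_top hP hL r hk hgap]
    refine iSup_le fun p => ?_
    rintro _ ⟨F, rfl⟩
    obtain ⟨t, ht, -⟩ := exists_eq_const_of_preconnected hP r p (hconn p) F.2
    exact ⟨_, (extendLink_eq_coboundary_single r p ht).symm⟩
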